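/- Let $d,k\ge 2$ be integers and let $T=\mathcal T_{d,k}$ be the rooted tree whose root has $k$ descendants and in which every other vertex has $d$ descendants. An almost automorphism of $T$ is a triple $(A,B,\varphi)$, where $A,B$ are finite subtrees containing the root with $|\partial A|=|\partial B|$ and $\varphi\colon T\setminus A\to T\setminus B$ is an isomorphism of rooted forests. The Neretin group $G=\mathcal N_{d,k}$ is the group of almost automorphisms modulo the relation identifying $(A,B,\varphi)$ and $(A',B',\varphi')$ when $\varphi$ and $\varphi'$ coincide outside some finite subtree containing $A\cup A'$; it carries the unique locally compact group topology for which the inclusion of the profinite group $\mathrm{Aut}(T)$ of automorphisms of the rooted tree is continuous and open. The group $G$ acts on the set of ends $\partial T$. Let $O=\mathcal O_{d,k}\le G$ be the subgroup of the elements that can be represented by some $(A,B,\varphi)$ with $A=B$ a ball around the root. Let $v_1,\dots,v_k$ be the descendants of the root and let $\partial T_{v_i}\subset\partial T$ be the set of ends whose ray from the root passes through $v_i$. Let $O_i\le O$ be the subgroup of the elements of $O$ that fix every end in $\partial T\setminus\partial T_{v_i}$, let $P=\langle O_1\cup\dots\cup O_k\rangle$ (the direct product of the $O_i$), and let $O'=N_O(P)$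 be the normalizer of $P$ in $O$. Then $O$ and $O'$ are open amenable subgroups of $G$. For an open subgroup $H\le G$ let $\lambda_{G/H}$ be the quasi-regular representation of $G$ on $\ell^2(G/H)$, $(\lambda_{G/H}(g)f)(x)=f(g^{-1}x)$. The (strongly continuous) unitary representations $\lambda_{G/O}$ and $\lambda_{G/O'}$ are both irreducible, and they are not unitarily equivalent. In particular, $G$ has two open amenable subgroups whose quasi-regular representations are irreducible and inequivalent. -/

import Mathlib

open Filter

noncomputable section

namespace Neretin

/-! ### The rooted tree, its finite subtrees, and almost automorphisms -/

/-- Vertices of the rooted tree `T_{d,k}`: the root has `k` descendants and every other vertex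
has `d` descendants. The vertex `node i [j_n, …, j_1]` is reached from the root by first going
to the `i`-th descendant and then following the letters `j_1, …, j_n`. -/
inductive Vertex (d k : ℕ) : Type
  | root : Vertex d k
  | node (i : Fin k) (w : List (Fin d)) : Vertex d k

variable {d k : ℕ}

namespace Vertex

/-- The parent of a vertex (with the convention that the root is its own parent). -/
def parent : Vertex d k → Vertex d k
  | root => root
  | node _ [] => root
  | node i (_ :: w) => node i w

/-- The level of a vertex: its distance from the root. -/
def level : Vertex d k → ℕ
  | root => 0
  | node _ w => w.length + 1

/-- `IsParent u v`: the vertex `v` is a descendant (child) of `u`. -/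
def IsParent (u v : Vertex d k) : Prop := v ≠ root ∧ parent v = u

theorem level_eq_zero {v : Vertex d k} : v.level = 0 ↔ v = root := by
  cases v <;> simp [level]

theorem level_parent (v : Vertex d k) : v.parent.level = v.level - 1 := by
  rcases v with _ | ⟨i, _ | ⟨j, w⟩⟩ <;> simp [level, parent]

theorem IsParent.level {u v : Vertex d k} (h : IsParent u v) : v.level = u.level + 1 := by
  have h1 := level_parent v
  have h2 : v.level ≠ 0 := fun h0 => h.1 (level_eq_zero.1 h0)
  rw [h.2] at h1
  omega

theorem finite_level_le (n : ℕ) : {v : Vertex d k | v.level ≤ n}.Finite := by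
  have h : ((fun p : Fin k × List (Fin d) => node p.1 p.2) ''
      (Set.univ ×ˢ {w : List (Fin d) | w.length ≤ n}) ∪ {root}).Finite :=
    ((Set.finite_univ.prod (List.finite_length_le _ n)).image _).union (Set.finite_singleton _)
  refine h.subset ?_
  rintro (_ | ⟨i, w⟩) hv
  · right; rfl
  · left
    refine ⟨(i, w), ⟨trivial, ?_⟩, rfl⟩
    simp only [Set.mem_ofPred_eq, level] at hv ⊢
    omega

theorem exists_level_bound {s : Set (Vertex d k)} (hs : s.Finite) :
    ∃ n, ∀ v ∈ s, v.level ≤ n := by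
  obtain ⟨n, hn⟩ := (hs.image level).bddAbove
  exact ⟨n, fun v hv => hn ⟨v, hv, rfl⟩⟩

end Vertex

open Vertex

/-- A finite subtree of `T_{d,k}` containing the root. A set of vertices that contains the root
spans a subtree (a connected subgraph) exactly when it is closed under passing to the parent. -/
@[ext] structure Subtree (d k : ℕ) : Type where
  verts : Set (Vertex d k)
  finite : verts.Finite
  root_mem : root ∈ verts
  parent_mem : ∀ v ∈ verts, v.parent ∈ verts

namespace Subtree

/-- The boundary `∂A`: the vertices outside `A` that are adjacent to a vertex of `A`. They are
the roots of the components of the forest `T_{d,k} ∖ A`. -/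
def boundary (A : Subtree d k) : Set (Vertex d k) := {v | v ∉ A.verts ∧ v.parent ∈ A.verts}

/-- The ball of radius `n` around the root. -/
def ball (d k n : ℕ) : Subtree d k where
  verts := {v | v.level ≤ n}
  finite := finite_level_le n
  root_mem := Nat.zero_le n
  parent_mem v hv := by
    simp only [Set.mem_ofPred_eq, level_parent] at hv ⊢
    omega

end Subtree

/-- An almost automorphism `(A, B, φ)` of `T_{d,k}`: two finite subtrees `A`, `B` containing the
root with `|∂A| = |∂B|`, and an isomorphism `φ : T_{d,k} ∖ A → T_{d,k} ∖ B` of rooted forests.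
(A graph isomorphism between these forests automatically respects parents: the roots of the
components are the vertices with `d` neighbours, all others have `d + 1`.) -/
structure AlmostAut (d k : ℕ) : Type where
  A : Subtree d k
  B : Subtree d k
  card_boundary : A.boundary.ncard = B.boundary.ncard
  φ : {v // v ∉ A.verts} ≃ {v // v ∉ B.verts}
  isParent_iff : ∀ u v, IsParent (φ u).1 (φ v).1 ↔ IsParent u.1 v.1

namespace AlmostAut

/-- The identification of almost automorphisms: `(A, B, φ)` and `(A', B', φ')`
are identified if `φ` and `φ'` coincide outside some finite subtree containing `A ∪ A'`. -/
def Equivalent (a b : AlmostAut d k) : Prop :=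
  ∃ C : Subtree d k, ∃ hA : a.A.verts ⊆ C.verts, ∃ hB : b.A.verts ⊆ C.verts,
    ∀ v (hv : v ∉ C.verts), (a.φ ⟨v, fun h => hv (hA h)⟩).1 = (b.φ ⟨v, fun h => hv (hB h)⟩).1

open Classical in
/-- The map `φ`, extended by the identity on `A`. -/
def ext (a : AlmostAut d k) (v : Vertex d k) : Vertex d k :=
  if h : v ∉ a.A.verts then (a.φ ⟨v, h⟩).1 else v

theorem ext_of_notMem (a : AlmostAut d k) {v : Vertex d k} (h : v ∉ a.A.verts) :
    a.ext v = (a.φ ⟨v, h⟩).1 := dif_pos h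

theorem ext_notMem (a : AlmostAut d k) {v : Vertex d k} (h : v ∉ a.A.verts) :
    a.ext v ∉ a.B.verts := by
  rw [ext_of_notMem a h]; exact (a.φ ⟨v, h⟩).2

theorem isParent_ext (a : AlmostAut d k) {u v : Vertex d k} (hu : u ∉ a.A.verts)
    (hv : v ∉ a.A.verts) : IsParent (a.ext u) (a.ext v) ↔ IsParent u v := by
  rw [ext_of_notMem a hu, ext_of_notMem a hv]; exact a.isParent_iff _ _

theorem equivalent_iff (a b : AlmostAut d k) : a.Equivalent b ↔ a.ext =ᶠ[cofinite] b.ext := by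
  constructor
  · rintro ⟨C, hA, hB, h⟩
    filter_upwards [C.finite.compl_mem_cofinite] with v hv
    rw [ext_of_notMem a fun h' => hv (hA h'), ext_of_notMem b fun h' => hv (hB h')]
    exact h v hv
  · intro h
    obtain ⟨n, hn⟩ := exists_level_bound
      ((a.A.finite.union b.A.finite).union (eventually_cofinite.1 h))
    refine ⟨Subtree.ball d k n, fun v hv => hn v (.inl (.inl hv)),
      fun v hv => hn v (.inl (.inr hv)), fun v hv => ?_⟩
    rw [← ext_of_notMem, ← ext_of_notMem]
    by_contra hne
    exact hv (hn v (.inr hne))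

instance setoid (d k : ℕ) : Setoid (AlmostAut d k) where
  r := Equivalent
  iseqv := by
    refine ⟨fun a => ?_, fun {a b} h => ?_, fun {a b c} h h' => ?_⟩
    · rw [equivalent_iff]
    · rw [equivalent_iff] at *; exact h.symm
    · rw [equivalent_iff] at *; exact h.trans h'

/-- The inverse almost automorphism `(B, A, φ⁻¹)`. -/
def inv (a : AlmostAut d k) : AlmostAut d k where
  A := a.B
  B := a.A
  card_boundary := a.card_boundary.symm
  φ := a.φ.symm
  isParent_iff u v := by rw [← a.isParent_iff]; simp

theorem inv_inv (a : AlmostAut d k) : a.inv.inv = a := rfl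

theorem ext_inv_ext (a : AlmostAut d k) {v : Vertex d k} (h : v ∉ a.A.verts) :
    a.inv.ext (a.ext v) = v := by
  rw [ext_of_notMem a.inv (a.ext_notMem h)]
  simp only [ext_of_notMem a h]
  exact congrArg Subtype.val (a.φ.symm_apply_apply ⟨v, h⟩)

theorem ext_ext_inv (a : AlmostAut d k) {v : Vertex d k} (h : v ∉ a.B.verts) :
    a.ext (a.inv.ext v) = v := a.inv.ext_inv_ext h

theorem ext_inv_notMem (a : AlmostAut d k) {v : Vertex d k} (h : v ∉ a.B.verts) :
    a.inv.ext v ∉ a.A.verts := a.inv.ext_notMem h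

/-- `φ` maps roots of components to roots of components. -/
theorem ext_mem_boundary (a : AlmostAut d k) {v : Vertex d k} (h : v ∈ a.A.boundary) :
    a.ext v ∈ a.B.boundary := by
  refine ⟨a.ext_notMem h.1, ?_⟩
  by_contra hp
  have h1 : IsParent (a.ext v).parent (a.ext v) :=
    ⟨fun h0 => a.ext_notMem h.1 (h0 ▸ a.B.root_mem), rfl⟩
  have h2 := (a.inv.isParent_ext hp (a.ext_notMem h.1)).2 h1
  rw [a.ext_inv_ext h.1] at h2
  exact a.ext_inv_notMem hp (h2.2 ▸ h.2)

theorem tendsto_ext (a : AlmostAut d k) : Tendsto a.ext cofinite cofinite := by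
  intro s hs
  rw [mem_map, mem_cofinite]
  rw [mem_cofinite] at hs
  refine (a.A.finite.union (hs.image a.inv.ext)).subset fun v hv => ?_
  by_cases h : v ∈ a.A.verts
  · exact .inl h
  · exact .inr ⟨a.ext v, hv, a.ext_inv_ext h⟩

/-- The finite subtree `A ∪ φ⁻¹(C)`. -/
def pullback (a : AlmostAut d k) (C : Subtree d k) : Subtree d k where
  verts := {v | v ∉ a.A.verts → a.ext v ∈ C.verts}
  finite := by
    refine (a.A.finite.union (C.finite.image a.inv.ext)).subset fun v hv => ?_
    by_cases h : v ∈ a.A.verts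
    · exact .inl h
    · exact .inr ⟨a.ext v, hv h, a.ext_inv_ext h⟩
  root_mem h := absurd a.A.root_mem h
  parent_mem v hv hp := by
    have hvA : v ∉ a.A.verts := fun h => hp (a.A.parent_mem v h)
    have h1 : IsParent v.parent v := ⟨fun h0 => hvA (h0 ▸ a.A.root_mem), rfl⟩
    rw [← ((a.isParent_ext hp hvA).2 h1).2]
    exact C.parent_mem _ (hv hvA)

theorem notMem_pullback {a : AlmostAut d k} {C : Subtree d k} {v : Vertex d k} :
    v ∉ (a.pullback C).verts ↔ v ∉ a.A.verts ∧ a.ext v ∉ C.verts := by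
  simp [pullback]

/-- An almost automorphism from mutually inverse maps of forests; the condition on boundaries is
automatic. -/
def ofMaps (A B : Subtree d k) (f g : Vertex d k → Vertex d k)
    (hf : ∀ v ∉ A.verts, f v ∉ B.verts) (hg : ∀ v ∉ B.verts, g v ∉ A.verts)
    (hgf : ∀ v ∉ A.verts, g (f v) = v) (hfg : ∀ v ∉ B.verts, f (g v) = v)
    (hpar : ∀ u ∉ A.verts, ∀ v ∉ A.verts, IsParent (f u) (f v) ↔ IsParent u v) :
    AlmostAut d k where
  A := A
  B := B
  card_boundary := by
    have key : ∀ v ∉ A.verts, f v ∈ B.boundary ↔ v ∈ A.boundary := by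
      intro v hv
      have hv0 : IsParent v.parent v := ⟨fun h0 => hv (h0 ▸ A.root_mem), rfl⟩
      have hf0 : IsParent (f v).parent (f v) := ⟨fun h0 => hf v hv (h0 ▸ B.root_mem), rfl⟩
      constructor
      · intro h
        refine ⟨hv, by_contra fun hp => ?_⟩
        have h2 := (hpar _ hp v hv).2 hv0
        exact hf _ hp (h2.2 ▸ h.2)
      · intro h
        refine ⟨hf v hv, by_contra fun hp => ?_⟩
        have h1 : IsParent (f (g (f v).parent)) (f v) := by rw [hfg _ hp]; exact hf0
        have h2 := (hpar _ (hg _ hp) v hv).1 h1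
        exact hg _ hp (h2.2 ▸ h.2)
    refine Set.ncard_congr (fun v _ => f v) (fun v h => (key v h.1).2 h) ?_ ?_
    · intro u v hu hv huv
      rw [← hgf u hu.1, huv, hgf v hv.1]
    · intro w hw
      refine ⟨g w, (key _ (hg w hw.1)).1 ?_, hfg w hw.1⟩
      rw [hfg w hw.1]; exact hw
  φ := ⟨fun v => ⟨f v.1, hf _ v.2⟩, fun v => ⟨g v.1, hg _ v.2⟩,
    fun v => Subtype.ext (hgf _ v.2), fun v => Subtype.ext (hfg _ v.2)⟩
  isParent_iff u v := hpar _ u.2 _ v.2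

/-- The composite `a ∘ b`, defined outside a sufficiently large finite subtree. -/
def comp (a b : AlmostAut d k) : AlmostAut d k :=
  ofMaps (b.pullback a.A) (a.inv.pullback b.B) (fun v => a.ext (b.ext v))
    (fun v => b.inv.ext (a.inv.ext v))
    (fun v hv => by
      rw [notMem_pullback] at *
      exact ⟨a.ext_notMem hv.2, by rw [a.ext_inv_ext hv.2]; exact b.ext_notMem hv.1⟩)
    (fun v hv => by
      rw [notMem_pullback] at *
      exact ⟨b.ext_inv_notMem hv.2, by
        rw [b.ext_ext_inv hv.2]; exact a.ext_inv_notMem hv.1⟩)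
    (fun v hv => by
      rw [notMem_pullback] at hv
      rw [a.ext_inv_ext hv.2, b.ext_inv_ext hv.1])
    (fun v hv => by
      rw [notMem_pullback] at hv
      rw [b.ext_ext_inv hv.2, a.ext_ext_inv hv.1])
    (fun u hu v hv => by
      rw [notMem_pullback] at hu hv
      rw [a.isParent_ext hu.2 hv.2, b.isParent_ext hu.1 hv.1])

theorem ext_comp (a b : AlmostAut d k) :
    (a.comp b).ext =ᶠ[cofinite] fun v => a.ext (b.ext v) := by
  filter_upwards [(a.comp b).A.finite.compl_mem_cofinite] with v hv
  exact ext_of_notMem _ hv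

theorem ext_inv (a : AlmostAut d k) : (fun v => a.inv.ext (a.ext v)) =ᶠ[cofinite] id := by
  filter_upwards [a.A.finite.compl_mem_cofinite] with v hv
  exact a.ext_inv_ext hv

end AlmostAut

/-! ### Automorphisms of the rooted tree -/

/-- The group `Aut(T_{d,k})` of automorphisms of the rooted tree. -/
def treeAut (d k : ℕ) : Subgroup (Equiv.Perm (Vertex d k)) where
  carrier := {σ | ∀ u v, IsParent (σ u) (σ v) ↔ IsParent u v}
  mul_mem' {σ τ} hσ hτ u v := (hσ _ _).trans (hτ _ _)
  one_mem' _ _ := Iff.rfl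
  inv_mem' {σ} hσ u v := by
    rw [← hσ]; simp

theorem treeAut_isParent (σ : treeAut d k) (u v : Vertex d k) :
    IsParent (σ.1 u) (σ.1 v) ↔ IsParent u v := σ.2 u v

theorem treeAut_root (σ : treeAut d k) : σ.1 root = root := by
  by_contra h
  have h1 : IsParent (σ.1 root).parent (σ.1 root) := ⟨h, rfl⟩
  have h2 := (treeAut_isParent σ⁻¹ _ _).2 h1
  have h3 : (σ⁻¹ : treeAut d k).1 (σ.1 root) = root := by simp
  rw [h3] at h2
  exact h2.1 rfl

instance : TopologicalSpace (Vertex d k) := ⊥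
instance : DiscreteTopology (Vertex d k) := ⟨rfl⟩

/-- The usual (profinite) topology on `Aut(T_{d,k})`: the topology of pointwise convergence on
the discrete set of vertices. -/
instance : TopologicalSpace (treeAut d k) :=
  TopologicalSpace.induced (fun σ (v : Vertex d k) => σ.1 v) inferInstance

theorem mem_ball_zero {v : Vertex d k} : v ∈ (Subtree.ball d k 0).verts ↔ v = root := by
  simp [Subtree.ball, level_eq_zero]

/-- A tree automorphism, viewed as an almost automorphism with `A = B = {root}`. -/
def AlmostAut.ofAut (σ : treeAut d k) : AlmostAut d k :=
  AlmostAut.ofMaps (Subtree.ball d k 0) (Subtree.ball d k 0) σ.1 (σ⁻¹ : treeAut d k).1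
    (fun v hv h => hv <| by
      rw [mem_ball_zero] at *
      exact σ.1.injective (h.trans (treeAut_root σ).symm))
    (fun v hv h => hv <| by
      rw [mem_ball_zero] at *
      exact (σ⁻¹ : treeAut d k).1.injective (h.trans (treeAut_root σ⁻¹).symm))
    (fun v _ => by simp) (fun v _ => by simp) (fun u _ v _ => treeAut_isParent σ u v)

theorem AlmostAut.ext_ofAut (σ : treeAut d k) (v : Vertex d k) :
    (AlmostAut.ofAut σ).ext v = σ.1 v := by
  by_cases h : v ∈ (Subtree.ball d k 0).verts
  · rw [mem_ball_zero] at h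
    subst h
    rw [treeAut_root]
    exact dif_neg (not_not.2 (Subtree.ball d k 0).root_mem)
  · exact AlmostAut.ext_of_notMem _ h

end Neretin

open Neretin Vertex

/-! ### The Neretin group -/

/-- The Neretin group `N_{d,k}`: the group of almost automorphisms of `T_{d,k}` modulo
identification outside finite subtrees. -/
def NeretinGroup (d k : ℕ) : Type := Quotient (AlmostAut.setoid d k)

namespace NeretinGroup

variable {d k : ℕ}

/-- The class of an almost automorphism. -/
def mk (a : AlmostAut d k) : NeretinGroup d k := Quotient.mk _ a

theorem mk_eq_mk {a b : AlmostAut d k} : mk a = mk b ↔ a.ext =ᶠ[cofinite] b.ext :=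
  Quotient.eq.trans (AlmostAut.equivalent_iff a b)

theorem exists_mk (g : NeretinGroup d k) : ∃ a, g = mk a :=
  ⟨g.out, (Quotient.out_eq g).symm⟩

instance : One (NeretinGroup d k) := ⟨mk (AlmostAut.ofAut 1)⟩

/-- Multiplication is composition: `mk a * mk b = mk (a ∘ b)`. -/
instance : Mul (NeretinGroup d k) :=
  ⟨Quotient.map₂ AlmostAut.comp fun a a' ha b b' hb => by
    have ha := (AlmostAut.equivalent_iff a a').1 ha
    have hb := (AlmostAut.equivalent_iff b b').1 hb
    refine (AlmostAut.equivalent_iff _ _).2 ?_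
    filter_upwards [a.ext_comp b, a'.ext_comp b', hb, b.tendsto_ext.eventually ha]
      with v h1 h2 h3 h4
    rw [h1, h2, h4, h3]⟩

instance : Inv (NeretinGroup d k) :=
  ⟨Quotient.map AlmostAut.inv fun a b h => by
    have h := (AlmostAut.equivalent_iff a b).1 h
    refine (AlmostAut.equivalent_iff _ _).2 ?_
    filter_upwards [a.inv.tendsto_ext.eventually h, a.inv.ext_inv, b.ext_inv,
      a.inv.tendsto_ext.eventually b.ext_inv] with v h1 h2 h3 h4
    rw [AlmostAut.inv_inv] at h2
    simp only [id] at h2 h4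
    rw [← h1, h2] at h4
    exact h4.symm⟩

theorem mk_mul_mk (a b : AlmostAut d k) : mk a * mk b = mk (a.comp b) := rfl

theorem mk_inv (a : AlmostAut d k) : (mk a)⁻¹ = mk a.inv := rfl

theorem one_def : (1 : NeretinGroup d k) = mk (AlmostAut.ofAut 1) := rfl

instance : Group (NeretinGroup d k) :=
  Group.ofLeftAxioms
    (by
      intro x y z
      obtain ⟨a, rfl⟩ := exists_mk x
      obtain ⟨b, rfl⟩ := exists_mk y
      obtain ⟨c, rfl⟩ := exists_mk z
      simp only [mk_mul_mk, mk_eq_mk]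
      filter_upwards [(a.comp b).ext_comp c, a.ext_comp (b.comp c), b.ext_comp c,
        c.tendsto_ext.eventually (a.ext_comp b)] with v h1 h2 h3 h4
      rw [h1, h2, h4, h3])
    (by
      intro x
      obtain ⟨a, rfl⟩ := exists_mk x
      rw [one_def, mk_mul_mk, mk_eq_mk]
      filter_upwards [(AlmostAut.ofAut 1).ext_comp a] with v h
      rw [h, AlmostAut.ext_ofAut]
      simp)
    (by
      intro x
      obtain ⟨a, rfl⟩ := exists_mk x
      rw [one_def, mk_inv, mk_mul_mk, mk_eq_mk]
      filter_upwards [a.inv.ext_comp a, a.ext_inv] with v h h'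
      rw [h, h', AlmostAut.ext_ofAut]
      simp)

/-- The natural inclusion `Aut(T_{d,k}) → N_{d,k}`. -/
def ofTreeAut (d k : ℕ) : treeAut d k →* NeretinGroup d k where
  toFun σ := mk (AlmostAut.ofAut σ)
  map_one' := rfl
  map_mul' σ τ := by
    rw [mk_mul_mk, mk_eq_mk]
    filter_upwards [(AlmostAut.ofAut σ).ext_comp (AlmostAut.ofAut τ)] with v h
    rw [h]
    simp [AlmostAut.ext_ofAut]

/-- The topology of `N_{d,k}`: a set is open if all its left translates have open preimage in
`Aut(T_{d,k})`. This is the unique group topology for which the inclusion of `Aut(T_{d,k})` is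
continuous and open (see the three facts below). -/
instance : TopologicalSpace (NeretinGroup d k) where
  IsOpen U := ∀ g, IsOpen {σ : treeAut d k | g * ofTreeAut d k σ ∈ U}
  isOpen_univ g := by simp
  isOpen_inter U V hU hV g := (hU g).inter (hV g)
  isOpen_sUnion S hS g := by
    have : {σ : treeAut d k | g * ofTreeAut d k σ ∈ ⋃₀ S} =
        ⋃ U ∈ S, {σ : treeAut d k | g * ofTreeAut d k σ ∈ U} := by
      ext σ; simp
    rw [this]
    exact isOpen_biUnion fun U hU => hS U hU g

theorem isOpen_treeAut_iff {U : Set (treeAut d k)} : IsOpen U ↔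
    ∀ σ ∈ U, ∃ n, ∀ τ : treeAut d k, (∀ v, v.level ≤ n → τ.1 v = v) → σ * τ ∈ U := by
  constructor
  · intro hU σ hσ
    obtain ⟨W, hW, rfl⟩ := isOpen_induced_iff.1 hU
    obtain ⟨I, u, hu, hsub⟩ := isOpen_pi_iff.1 hW _ hσ
    obtain ⟨n, hn⟩ := exists_level_bound I.finite_toSet
    refine ⟨n, fun τ hτ => hsub fun v hv => ?_⟩
    have : (σ * τ).1 v = σ.1 v := by
      simp [hτ v (hn v hv)]
    change (σ * τ).1 v ∈ u v
    rw [this]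
    exact (hu v hv).2
  · intro h
    rw [isOpen_iff_forall_mem_open]
    intro σ hσ
    obtain ⟨n, hn⟩ := h σ hσ
    refine ⟨{τ | ∀ v : Vertex d k, v.level ≤ n → τ.1 v = σ.1 v}, fun τ hτ => ?_, ?_,
      fun v _ => rfl⟩
    · have := hn (σ⁻¹ * τ) fun v hv => by simp [hτ v hv]
      simpa using this
    · refine isOpen_induced_iff.2 ⟨{f | ∀ v ∈ {v : Vertex d k | v.level ≤ n}, f v = σ.1 v},
        ?_, rfl⟩
      have : {f : Vertex d k → Vertex d k | ∀ v ∈ {v : Vertex d k | v.level ≤ n}, f v = σ.1 v} =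
          Set.pi {v : Vertex d k | v.level ≤ n} fun v => {σ.1 v} := by
        ext f; simp [Set.mem_pi]
      rw [this]
      exact isOpen_set_pi (finite_level_le n) fun v _ => isOpen_discrete _

theorem isOpen_iff {U : Set (NeretinGroup d k)} : IsOpen U ↔
    ∀ g ∈ U, ∃ n, ∀ τ : treeAut d k, (∀ v, v.level ≤ n → τ.1 v = v) →
      g * ofTreeAut d k τ ∈ U := by
  constructor
  · intro hU g hg
    obtain ⟨n, hn⟩ := isOpen_treeAut_iff.1 (hU g) 1 (by simpa using hg)
    exact ⟨n, fun τ hτ => by simpa using hn τ hτ⟩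
  · intro h g
    refine isOpen_treeAut_iff.2 fun σ hσ => ?_
    obtain ⟨n, hn⟩ := h _ hσ
    exact ⟨n, fun τ hτ => by simpa [mul_assoc] using hn τ hτ⟩

theorem continuous_ofTreeAut : Continuous (ofTreeAut d k) :=
  ⟨fun U hU => by
    have h := hU 1
    simp only [one_mul] at h
    exact h⟩

theorem isOpenMap_ofTreeAut : IsOpenMap (ofTreeAut d k) := by
  intro U hU
  refine isOpen_iff.2 ?_
  rintro _ ⟨σ, hσ, rfl⟩
  obtain ⟨n, hn⟩ := isOpen_treeAut_iff.1 hU σ hσ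
  exact ⟨n, fun τ hτ => ⟨σ * τ, hn τ hτ, map_mul _ _ _⟩⟩

theorem exists_conj (g : NeretinGroup d k) (n : ℕ) : ∃ m, ∀ σ : treeAut d k,
    (∀ v, v.level ≤ m → σ.1 v = v) → ∃ τ : treeAut d k, (∀ v, v.level ≤ n → τ.1 v = v) ∧
      g * ofTreeAut d k σ = ofTreeAut d k τ * g := by
  classical
  obtain ⟨a, rfl⟩ := exists_mk g
  obtain ⟨b, hb⟩ := exists_level_bound a.B.finite
  obtain ⟨m, hm⟩ := exists_level_bound (a.pullback (Subtree.ball d k (max n (b + 1)))).finite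
  have hmA : ∀ v ∈ a.A.verts, v.level ≤ m := fun v hv => hm v fun h => absurd hv h
  have hmB : ∀ w ∉ a.B.verts, w.level ≤ max n (b + 1) → (a.inv.ext w).level ≤ m := by
    intro w hw hl
    refine hm _ fun _ => ?_
    rw [a.ext_ext_inv hw]
    exact hl
  have hpresA : ∀ σ : treeAut d k, (∀ v, v.level ≤ m → σ.1 v = v) →
      ∀ v ∉ a.A.verts, σ.1 v ∉ a.A.verts := by
    intro σ hσ v hv h
    have := σ.1.injective (hσ _ (hmA _ h))
    rw [this] at h
    exact hv h
  let F : treeAut d k → Vertex d k → Vertex d k := fun σ w =>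
    if w ∈ a.B.verts then w else a.ext (σ.1 (a.inv.ext w))
  have hF1 : ∀ σ w, w ∈ a.B.verts → F σ w = w := fun σ w hw => if_pos hw
  have hF2 : ∀ σ w, w ∉ a.B.verts → F σ w = a.ext (σ.1 (a.inv.ext w)) :=
    fun σ w hw => if_neg hw
  have hF3 : ∀ σ : treeAut d k, (∀ v, v.level ≤ m → σ.1 v = v) →
      ∀ w ∉ a.B.verts, F σ w ∉ a.B.verts := by
    intro σ hσ w hw
    rw [hF2 _ _ hw]
    exact a.ext_notMem (hpresA σ hσ _ (a.ext_inv_notMem hw))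
  have hF4 : ∀ σ : treeAut d k, (∀ v, v.level ≤ m → σ.1 v = v) →
      ∀ w, w.level ≤ max n (b + 1) → F σ w = w := by
    intro σ hσ w hl
    by_cases hw : w ∈ a.B.verts
    · exact hF1 _ _ hw
    · rw [hF2 _ _ hw, hσ _ (hmB w hw hl), a.ext_ext_inv hw]
  have hFinv : ∀ σ : treeAut d k, (∀ v, v.level ≤ m → σ.1 v = v) →
      ∀ w, F σ⁻¹ (F σ w) = w := by
    intro σ hσ w
    by_cases hw : w ∈ a.B.verts
    · rw [hF1 _ _ hw, hF1 _ _ hw]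
    · rw [hF2 _ _ (hF3 σ hσ w hw), hF2 _ _ hw,
        a.ext_inv_ext (hpresA σ hσ _ (a.ext_inv_notMem hw))]
      simp [a.ext_ext_inv hw]
  have hFpar : ∀ σ : treeAut d k, (∀ v, v.level ≤ m → σ.1 v = v) →
      ∀ u v, IsParent u v → IsParent (F σ u) (F σ v) := by
    intro σ hσ u v huv
    by_cases hv : v ∈ a.B.verts
    · have hu : u ∈ a.B.verts := huv.2 ▸ a.B.parent_mem v hv
      rwa [hF1 _ _ hv, hF1 _ _ hu]
    by_cases hu : u ∈ a.B.verts
    · have h1 := huv.level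
      have h2 := hb u hu
      rw [hF1 _ _ hu, hF4 σ hσ v (by omega)]
      exact huv
    · rw [hF2 _ _ hu, hF2 _ _ hv,
        a.isParent_ext (hpresA σ hσ _ (a.ext_inv_notMem hu)) (hpresA σ hσ _ (a.ext_inv_notMem hv)),
        treeAut_isParent, a.inv.isParent_ext hu hv]
      exact huv
  refine ⟨m, fun σ hσ => ?_⟩
  have hσ' : ∀ v, v.level ≤ m → (σ⁻¹ : treeAut d k).1 v = v := by
    intro v hv
    have h : (σ⁻¹ : treeAut d k).1 (σ.1 v) = v := by simp
    rwa [hσ v hv] at h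
  have hr : ∀ w, F σ (F σ⁻¹ w) = w := fun w => by
    have h := hFinv σ⁻¹ hσ' w
    rwa [_root_.inv_inv] at h
  refine ⟨⟨⟨F σ, F σ⁻¹, hFinv σ hσ, hr⟩, fun u v => ⟨fun h => ?_, hFpar σ hσ u v⟩⟩, ?_, ?_⟩
  · have h1 := hFpar σ⁻¹ hσ' _ _ h
    simp only [Equiv.coe_fn_mk] at h1
    rwa [hFinv σ hσ, hFinv σ hσ] at h1
  · exact fun v hv => hF4 σ hσ v (hv.trans (le_max_left _ _))
  · refine mk_eq_mk.2 ?_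
    filter_upwards [a.ext_comp (AlmostAut.ofAut σ), AlmostAut.ext_comp (AlmostAut.ofAut _) a,
      a.A.finite.compl_mem_cofinite] with v h1 h2 hv
    rw [h1, h2, AlmostAut.ext_ofAut, AlmostAut.ext_ofAut]
    change _ = F σ (a.ext v)
    rw [hF2 _ _ (a.ext_notMem hv), a.ext_inv_ext hv]

instance : IsTopologicalGroup (NeretinGroup d k) := by
  have hopen : ∀ (g : NeretinGroup d k) (n : ℕ), IsOpen {x | ∃ τ : treeAut d k,
      (∀ v, v.level ≤ n → τ.1 v = v) ∧ x = g * ofTreeAut d k τ} := by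
    intro g n
    refine isOpen_iff.2 ?_
    rintro _ ⟨τ, hτ, rfl⟩
    refine ⟨n, fun ρ hρ => ⟨τ * ρ, fun v hv => ?_, ?_⟩⟩
    · simp [hρ v hv, hτ v hv]
    · rw [map_mul, mul_assoc]
  have hself : ∀ (g : NeretinGroup d k) (n : ℕ), ∃ τ : treeAut d k,
      (∀ v, v.level ≤ n → τ.1 v = v) ∧ g = g * ofTreeAut d k τ :=
    fun g n => ⟨1, fun v _ => rfl, by simp⟩
  refine { continuous_mul := ⟨fun U hU => ?_⟩, continuous_inv := ⟨fun U hU => ?_⟩ }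
  · refine isOpen_prod_iff.2 fun g h hgh => ?_
    obtain ⟨n, hn⟩ := isOpen_iff.1 hU _ hgh
    obtain ⟨m, hm⟩ := exists_conj h⁻¹ n
    refine ⟨_, _, hopen g m, hopen h n, hself g m, hself h n, ?_⟩
    rintro ⟨_, _⟩ ⟨⟨σ, hσ, rfl⟩, ⟨τ, hτ, rfl⟩⟩
    obtain ⟨ρ, hρ, he⟩ := hm σ hσ
    have h2 := hn (ρ * τ) fun v hv => by simp [hτ v hv, hρ v hv]
    have h3 : ofTreeAut d k σ * h = h * ofTreeAut d k ρ := by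
      have : ofTreeAut d k ρ = h⁻¹ * ofTreeAut d k σ * h := by rw [he]; simp
      rw [this]; group
    rw [Set.mem_preimage]
    have h4 : g * ofTreeAut d k σ * (h * ofTreeAut d k τ) =
        g * h * ofTreeAut d k (ρ * τ) := by
      rw [map_mul, mul_assoc g, ← mul_assoc _ h, h3]; group
    exact h4 ▸ h2
  · refine isOpen_iff.2 fun g hg => ?_
    obtain ⟨n, hn⟩ := isOpen_iff.1 hU _ hg
    obtain ⟨m, hm⟩ := exists_conj g n
    refine ⟨m, fun σ hσ => ?_⟩
    obtain ⟨ρ, hρ, he⟩ := hm σ hσ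
    have h2 := hn ρ⁻¹ fun v hv => by
      have h : (ρ⁻¹ : treeAut d k).1 (ρ.1 v) = v := by simp
      rwa [hρ v hv] at h
    rw [Set.mem_preimage, he, mul_inv_rev, ← map_inv]
    exact h2

end NeretinGroup

/-! ### The action on the ends of the tree -/

/-- The set of ends `∂T_{d,k}`: infinite rays starting at the root. -/
@[ext] structure Ends (d k : ℕ) : Type where
  ray : ℕ → Vertex d k
  ray_zero : ray 0 = root
  isParent : ∀ n, IsParent (ray n) (ray (n + 1))

namespace Ends

variable {d k : ℕ}

/-- The set of ends `∂T_v` of the subtree `T_v` of the vertices separated from the root by `v`: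
the ends whose ray from the root passes through `v`. -/
def through (v : Vertex d k) : Set (Ends d k) := {ξ | ∃ n, ξ.ray n = v}

theorem level_apply (ξ : Ends d k) (n : ℕ) : (ξ.ray n).level = n := by
  induction n with
  | zero => rw [ξ.ray_zero]; rfl
  | succ n ih => rw [(ξ.isParent n).level, ih]

theorem tendsto_cofinite (ξ : Ends d k) : Tendsto ξ.ray atTop cofinite := by
  rw [← Nat.cofinite_eq_atTop]
  refine Function.Injective.tendsto_cofinite fun m n h => ?_
  rw [← level_apply ξ m, h, level_apply]

theorem parent_iterate (ξ : Ends d k) (m j : ℕ) : parent^[j] (ξ.ray (m + j)) = ξ.ray m := by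
  induction j with
  | zero => rfl
  | succ j ih =>
    rw [Function.iterate_succ_apply, ← Nat.add_assoc, (ξ.isParent (m + j)).2, ih]

/-- `Maps f ξ η`: the map `f` sends the tail of the ray `ξ` into the ray `η`. -/
def Maps (f : Vertex d k → Vertex d k) (ξ η : Ends d k) : Prop :=
  ∀ᶠ n in atTop, f (ξ.ray n) = η.ray (f (ξ.ray n)).level

theorem Maps.unique {a : AlmostAut d k} {ξ η η' : Ends d k} (h : Maps a.ext ξ η)
    (h' : Maps a.ext ξ η') : η = η' := by
  refine Ends.ext (funext fun m => ?_)
  have hbig : ∀ᶠ n in atTop, a.ext (ξ.ray n) ∉ {v : Vertex d k | v.level ≤ m} :=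
    (a.tendsto_ext.comp ξ.tendsto_cofinite).eventually
      (finite_level_le m).compl_mem_cofinite
  obtain ⟨n, h1, h2, h3⟩ := (h.and (h'.and hbig)).exists
  simp only [Set.mem_ofPred_eq, not_le] at h3
  have e := parent_iterate η m ((a.ext (ξ.ray n)).level - m)
  have e' := parent_iterate η' m ((a.ext (ξ.ray n)).level - m)
  rw [Nat.add_sub_cancel' h3.le] at e e'
  rw [← e, ← e', ← h1, ← h2]

theorem exists_maps (a : AlmostAut d k) (ξ : Ends d k) : ∃ η, Maps a.ext ξ η := by
  obtain ⟨N, hN⟩ := eventually_atTop.1 (ξ.tendsto_cofinite.eventually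
    a.A.finite.compl_mem_cofinite)
  set L := (a.ext (ξ.ray N)).level with hL
  have hstep : ∀ m, IsParent (a.ext (ξ.ray (N + m))) (a.ext (ξ.ray (N + m + 1))) := fun m =>
    (a.isParent_ext (hN _ (by omega)) (hN _ (by omega))).2 (ξ.isParent _)
  have hlev : ∀ m, (a.ext (ξ.ray (N + m))).level = L + m := by
    intro m
    induction m with
    | zero => rfl
    | succ m ih => rw [← Nat.add_assoc, (hstep m).level, ih]; rfl
  have hit : ∀ (j : ℕ) (v : Vertex d k), (parent^[j] v).level = v.level - j := by
    intro j
    induction j with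
    | zero => intro v; rfl
    | succ j ih => intro v; rw [Function.iterate_succ_apply, ih, level_parent]; omega
  let x : ℕ → Vertex d k := fun m => parent^[L] (a.ext (ξ.ray (N + m)))
  have hxl : ∀ m, (x m).level = m := fun m => by
    change (parent^[L] _).level = m
    rw [hit, hlev]; omega
  let η : Ends d k := ⟨x, level_eq_zero.1 (hxl 0), fun m => by
    refine ⟨fun h => ?_, ?_⟩
    · have := hxl (m + 1)
      rw [h] at this
      simp [level] at this
    · change parent (parent^[L] (a.ext (ξ.ray (N + m + 1)))) = parent^[L] (a.ext (ξ.ray (N + m)))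
      rw [← Function.iterate_succ_apply' parent, Function.iterate_succ_apply, (hstep m).2]⟩
  refine ⟨η, eventually_atTop.2 ⟨N, fun n hn => ?_⟩⟩
  obtain ⟨m, rfl⟩ := Nat.exists_eq_add_of_le hn
  rw [hlev]
  change _ = parent^[L] (a.ext (ξ.ray (N + (L + m))))
  have : ∀ j, parent^[j] (a.ext (ξ.ray (N + (j + m)))) = a.ext (ξ.ray (N + m)) := by
    intro j
    induction j with
    | zero => simp
    | succ j ih =>
      rw [Function.iterate_succ_apply, show N + (j + 1 + m) = N + (j + m) + 1 by omega,
        (hstep (j + m)).2, ih]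
  exact (this L).symm

theorem Maps.congr {f g : Vertex d k → Vertex d k} (h : f =ᶠ[cofinite] g) {ξ η : Ends d k}
    (hf : Maps f ξ η) : Maps g ξ η := by
  filter_upwards [hf, ξ.tendsto_cofinite.eventually h] with n h1 h2
  rwa [h2] at h1

theorem Maps.comp {a b : AlmostAut d k} {ξ η ζ : Ends d k} (hb : Maps b.ext ξ η)
    (ha : Maps a.ext η ζ) : Maps (a.comp b).ext ξ ζ := by
  refine Maps.congr (a.ext_comp b).symm ?_
  have ht : Tendsto (fun n => (b.ext (ξ.ray n)).level) atTop atTop := by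
    refine tendsto_atTop.2 fun m => ?_
    filter_upwards [(b.tendsto_ext.comp ξ.tendsto_cofinite).eventually
      (finite_level_le m).compl_mem_cofinite] with n hn
    exact (not_le.1 hn).le
  filter_upwards [hb, ht.eventually ha] with n h1 h2
  rwa [← h1] at h2

/-- The end `φ(ξ)`. -/
def map (a : AlmostAut d k) (ξ : Ends d k) : Ends d k := (exists_maps a ξ).choose

theorem map_spec (a : AlmostAut d k) (ξ : Ends d k) : Maps a.ext ξ (map a ξ) :=
  (exists_maps a ξ).choose_spec

/-- The action of `N_{d,k}` on `∂T_{d,k}`: the class of `(A, B, φ)` sends the end `ξ` to the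
unique end containing the image under `φ` of a tail of `ξ`. -/
instance : MulAction (NeretinGroup d k) (Ends d k) where
  smul g ξ := Quotient.lift (fun a => map a ξ) (fun a b h =>
    (((map_spec a ξ).congr ((AlmostAut.equivalent_iff a b).1 h)).unique (map_spec b ξ))) g
  one_smul ξ := by
    refine (map_spec (AlmostAut.ofAut 1) ξ).unique (Eventually.of_forall fun n => ?_)
    rw [AlmostAut.ext_ofAut]
    simp [level_apply]
  mul_smul g h ξ := by
    obtain ⟨a, rfl⟩ := NeretinGroup.exists_mk g
    obtain ⟨b, rfl⟩ := NeretinGroup.exists_mk h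
    exact (map_spec (a.comp b) ξ).unique ((map_spec b ξ).comp (map_spec a (map b ξ)))

end Ends

/-! ### The subgroups `O` and `O'` -/

namespace NeretinGroup

variable {d k : ℕ}

theorem level_ext_of_ball {a : AlmostAut d k} {n : ℕ} (hA : a.A = Subtree.ball d k n)
    (hB : a.B = Subtree.ball d k n) (v : Vertex d k) (hv : v ∉ a.A.verts) :
    (a.ext v).level = v.level := by
  have mem : ∀ v : Vertex d k, v ∈ (Subtree.ball d k n).verts ↔ v.level ≤ n := fun v => Iff.rfl
  induction hl : v.level generalizing v with
  | zero =>
    rw [hA, mem] at hv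
    omega
  | succ l ih =>
    have hp : IsParent v.parent v := ⟨fun h => hv (h ▸ a.A.root_mem), rfl⟩
    have hpl := hp.level
    by_cases h : v.parent ∈ a.A.verts
    · have h1 := a.ext_mem_boundary ⟨hv, h⟩
      have h2 := level_parent (a.ext v)
      have h3 := h1.1
      have h4 := h1.2
      rw [hB, mem] at h3 h4
      rw [hA, mem] at hv h
      omega
    · rw [((a.isParent_ext h hv).2 hp).level, ih _ h (by omega)]

/-- The open subgroup `O_{d,k}` of `N_{d,k}`: the elements represented by an almost automorphism
`(A, B, φ)` such that `A = B` is a ball around the root. -/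
def ballSubgroup (d k : ℕ) : Subgroup (NeretinGroup d k) where
  carrier := {g | ∃ (a : AlmostAut d k) (n : ℕ),
    a.A = Subtree.ball d k n ∧ a.B = Subtree.ball d k n ∧ mk a = g}
  one_mem' := ⟨AlmostAut.ofAut 1, 0, rfl, rfl, rfl⟩
  inv_mem' := by
    rintro _ ⟨a, n, hA, hB, rfl⟩
    exact ⟨a.inv, n, hB, hA, rfl⟩
  mul_mem' := by
    have key : ∀ (b : AlmostAut d k) (m n : ℕ), b.A = Subtree.ball d k m →
        b.B = Subtree.ball d k m →
        b.pullback (Subtree.ball d k n) = Subtree.ball d k (max m n) := by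
      intro b m n hA hB
      refine Subtree.ext (Set.ext fun v => not_iff_not.1 ?_)
      rw [AlmostAut.notMem_pullback]
      have h0 : v ∉ b.A.verts ↔ ¬ v.level ≤ m := by rw [hA]; rfl
      have h1 : v ∉ (Subtree.ball d k (max m n)).verts ↔ ¬ v.level ≤ max m n := Iff.rfl
      have h2 : b.ext v ∉ (Subtree.ball d k n).verts ↔ ¬ (b.ext v).level ≤ n := Iff.rfl
      rw [h1, h2]
      constructor
      · rintro ⟨h3, h4⟩
        rw [level_ext_of_ball hA hB v h3] at h4
        rw [h0] at h3
        omega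
      · intro h3
        have h4 : v ∉ b.A.verts := h0.2 (by omega)
        refine ⟨h4, ?_⟩
        rw [level_ext_of_ball hA hB v h4]
        omega
    rintro _ _ ⟨a, n, hA, hB, rfl⟩ ⟨b, m, hA', hB', rfl⟩
    refine ⟨a.comp b, max m n, ?_, ?_, rfl⟩
    · change b.pullback a.A = _
      rw [hA, key b m n hA' hB']
    · change a.inv.pullback b.B = _
      rw [hB', key a.inv n m hB hA, max_comm]

/-- The rigid stabilizer in a subgroup `H` of a set `α` of ends: the elements of `H` that fix
every end outside `α`. -/
def rigidStabilizer (H : Subgroup (NeretinGroup d k)) (α : Set (Ends d k)) :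
    Subgroup (NeretinGroup d k) :=
  H ⊓ fixingSubgroup (NeretinGroup d k) αᶜ

/-- The subgroup `P` generated by the rigid stabilizers `O_i` in `O = O_{d,k}` of the sets of ends
`∂T_{v_i}`, where `v_1, …, v_k` are the descendants of the root. The subgroups `O_i` have disjoint
supports, so that `P` is their direct product. -/
def levelOneProduct (d k : ℕ) : Subgroup (NeretinGroup d k) :=
  ⨆ i : Fin k, rigidStabilizer (ballSubgroup d k) (Ends.through (Vertex.node i []))

/-- The subgroup `O' = N_O(P)`. -/
def levelOneNormalizer (d k : ℕ) : Subgroup (NeretinGroup d k) :=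
  ballSubgroup d k ⊓ Subgroup.normalizer (levelOneProduct d k : Set (NeretinGroup d k))

end NeretinGroup

/-! ### Amenability and unitary representations -/

/-- Amenability of a topological group (used for locally compact groups): there is a
left-invariant mean on the bounded continuous real functions. -/
def IsAmenable (G : Type*) [Group G] [TopologicalSpace G] [IsTopologicalGroup G] : Prop :=
  ∃ m : BoundedContinuousFunction G ℝ →ₗ[ℝ] ℝ,
    (∀ f, 0 ≤ f → 0 ≤ m f) ∧
    m (BoundedContinuousFunction.const G 1) = 1 ∧
    ∀ (g : G) (f : BoundedContinuousFunction G ℝ),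
      m (f.compContinuous ⟨fun x => g * x, continuous_const_mul g⟩) = m f

namespace UnitaryRep

variable {G : Type*} [Group G]
variable {E : Type*} [NormedAddCommGroup E] [InnerProductSpace ℂ E]
variable {F : Type*} [NormedAddCommGroup F] [InnerProductSpace ℂ F]

/-- A homomorphism to the unitary group of a Hilbert space is strongly continuous if all its
orbit maps are continuous. -/
def IsStronglyContinuous [TopologicalSpace G] (π : G →* (E ≃ₗᵢ[ℂ] E)) : Prop :=
  ∀ v : E, Continuous fun g => π g v

/-- A unitary representation is irreducible if its space is non-zero and its only closed invariant
subspaces are `0` and the whole space. -/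
def IsIrreducible (π : G →* (E ≃ₗᵢ[ℂ] E)) : Prop :=
  Nontrivial E ∧ ∀ W : Submodule ℂ E, IsClosed (W : Set E) →
    (∀ g, ∀ v ∈ W, π g v ∈ W) → W = ⊥ ∨ W = ⊤

/-- Unitary equivalence: there is a unitary intertwiner. -/
def AreEquivalent (π : G →* (E ≃ₗᵢ[ℂ] E)) (ρ : G →* (F ≃ₗᵢ[ℂ] F)) : Prop :=
  ∃ U : E ≃ₗᵢ[ℂ] F, ∀ g v, U (π g v) = ρ g (U v)

/-- The Hilbert space `ℓ²(X)`. -/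
abbrev EllTwo (X : Type*) : Type _ := lp (fun _ : X => ℂ) 2

theorem memℓp_comp {X : Type*} (e : Equiv.Perm X) {f : X → ℂ} (hf : Memℓp f 2) :
    Memℓp (fun x => f (e x)) 2 := by
  rw [memℓp_gen_iff (by norm_num)] at hf ⊢
  exact e.summable_iff.2 hf

/-- Precomposition with a permutation, as a unitary operator of `ℓ²(X)`. -/
def permOp {X : Type*} (e : Equiv.Perm X) : EllTwo X ≃ₗᵢ[ℂ] EllTwo X where
  toFun f := ⟨fun x => f (e x), memℓp_comp e (lp.memℓp f)⟩
  invFun f := ⟨fun x => f (e.symm x), memℓp_comp e.symm (lp.memℓp f)⟩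
  map_add' f g := rfl
  map_smul' c f := rfl
  left_inv f := by ext x; simp
  right_inv f := by ext x; simp
  norm_map' f := by
    rw [lp.norm_eq_tsum_rpow (by norm_num), lp.norm_eq_tsum_rpow (by norm_num)]
    congr 1
    exact e.tsum_eq fun x => ‖f x‖ ^ (2 : ENNReal).toReal

/-- The quasi-regular representation `λ_{G/H}` on `ℓ²(G/H)` for an open subgroup `H` of `G` (the
coset space is then discrete): `(λ_{G/H}(g) f)(x) = f(g⁻¹ x)`. -/
def quasiRegular (H : Subgroup G) : G →* (EllTwo (G ⧸ H) ≃ₗᵢ[ℂ] EllTwo (G ⧸ H)) where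
  toFun g := permOp (MulAction.toPerm g⁻¹)
  map_one' := by
    ext f x
    simp [permOp]
  map_mul' g h := by
    ext f x
    simp [permOp, mul_smul]

theorem quasiRegular_apply (H : Subgroup G) (g : G) (f : EllTwo (G ⧸ H)) (x : G ⧸ H) :
    quasiRegular H g f x = f (g⁻¹ • x) := rfl

end UnitaryRep

end

/-! Both irreducibility and inequivalence are statements about orbits on coset spaces. A vector of
`ℓ²(G/K)` that is invariant under a subgroup `H` is constant on `H`-orbits, hence vanishes on the
infinite ones. If the base point is the only point of `G/H` with a finite `H`-orbit, the point mass
there spans the `H`-invariant vectors, and being cyclic it forces irreducibility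
(`isIrreducible_quasiRegular`). If all `H`-orbits in `G/K` are infinite, `ℓ²(G/K)` has no non-zero
`H`-invariant vector while `ℓ²(G/H)` has one (`not_areEquivalent_quasiRegular`).

Elements of `O` are those that eventually preserve the level; elements of `O'` moreover permute the
first letters, a first letter being the descendant of the root below which a vertex lies
(`mk_mem_ballSubgroup_iff`, `mk_mem_levelOneNormalizer_iff`). Suppose the `H`-orbit of `a⁻¹K` is
finite. Apply the pigeonhole principle to elements `s m` of `H` that transpose the cones at depth
`m` below two vertices `x`, `y` of equal level: for some `m < n`, the element `a (s m)⁻¹ (s n) a⁻¹`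
lies in `K`, or even in a prescribed subgroup of `K` cut out by finitely many colours. Some cone
below `x` is moved by `s m` but not by `s n`, so every vertex function preserved by that subgroup
takes equal values at the images under `a` of corresponding vertices below `x` and `y`
(`exists_descend_eq_of_finite_orbit`).

With the level as the function, `a` shifts levels by a constant, which is zero because `a` is a
bijection between cofinite sets of vertices whose levels grow exponentially (`shift_eq_zero`). With
the first letter as the function, `a` respects first letters. This identifies the finite orbits of
`O` on `G/O` and of `O'` on `G/O'`. For `O` acting on `G/O'` the transpositions may mix first
letters, so a finite orbit would make all images under `a` have the same first letter, impossible
for `k ≥ 2`.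

Amenability holds because `O` is an increasing union of compact subgroups, the elements defined
outside the ball of radius `n`; an ultralimit of their Haar means is invariant. -/

noncomputable section

open Neretin Vertex

namespace Neretin

variable {d k : ℕ}

/-! ### Cones in the tree and the transposition of two cones -/

namespace Vertex

/-- The descendant of the root above a given vertex, `none` for the root itself. -/
def letter : Vertex d k → Option (Fin k)
  | root => none
  | node i _ => some i

/-- The `j`-th child of a vertex other than the root. -/
def child (j : Fin d) : Vertex d k → Vertex d k
  | root => root
  | node i w => node i (j :: w)

/-- The vertex reached from a vertex other than the root by following a word. -/
def descend (w : List (Fin d)) : Vertex d k → Vertex d k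
  | root => root
  | node i u => node i (w ++ u)

theorem ne_root_of_level_eq {u v : Vertex d k} (hu : u ≠ root) (h : u.level = v.level) :
    v ≠ root := fun hv => hu (level_eq_zero.1 (h.trans (level_eq_zero.2 hv)))

theorem descend_ne_root {v : Vertex d k} (hv : v ≠ root) (w : List (Fin d)) :
    descend w v ≠ root := by
  cases v
  · exact absurd rfl hv
  · simp [descend]

theorem level_descend {v : Vertex d k} (hv : v ≠ root) (w : List (Fin d)) :
    (descend w v).level = v.level + w.length := by
  cases v
  · exact absurd rfl hv
  · simp [descend, level]; omega

theorem level_le_level_descend (v : Vertex d k) (w : List (Fin d)) :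
    v.level ≤ (descend w v).level := by
  cases v
  · simp [descend]
  · simp [descend, level]

@[simp] theorem letter_child (v : Vertex d k) (j : Fin d) : (child j v).letter = v.letter := by
  cases v <;> rfl

@[simp] theorem letter_descend (v : Vertex d k) (w : List (Fin d)) :
    (descend w v).letter = v.letter := by
  cases v <;> rfl

@[simp] theorem descend_nil (v : Vertex d k) : descend [] v = v := by
  cases v <;> rfl

theorem descend_cons (j : Fin d) (w : List (Fin d)) (v : Vertex d k) :
    descend (j :: w) v = child j (descend w v) := by
  cases v <;> rfl

theorem descend_append (u w : List (Fin d)) (v : Vertex d k) :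
    descend (u ++ w) v = descend u (descend w v) := by
  cases v <;> simp [descend]

theorem descend_right_injective {u w : List (Fin d)} (h : u.length = w.length) {x y : Vertex d k}
    (hx : x ≠ root) (hy : y ≠ root) (he : descend u x = descend w y) : u = w ∧ x = y := by
  cases x
  · exact absurd rfl hx
  cases y
  · exact absurd rfl hy
  simp only [descend, node.injEq] at he
  obtain ⟨h1, h2⟩ := List.append_inj he.2 h
  simp [he.1, h1, h2]

theorem descend_left_injective {v : Vertex d k} (hv : v ≠ root) :
    Function.Injective fun w => descend w v := by
  cases v
  · exact absurd rfl hv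
  · intro u w h
    simpa [descend] using h

theorem isParent_child {v : Vertex d k} (hv : v ≠ root) (j : Fin d) : IsParent v (child j v) := by
  cases v
  · exact absurd rfl hv
  · exact ⟨by simp [child], rfl⟩

theorem isParent_iff_child {u v : Vertex d k} (hu : u ≠ root) :
    IsParent u v ↔ ∃ j, v = child j u := by
  constructor
  · rintro ⟨h1, rfl⟩
    rcases v with _ | ⟨i, _ | ⟨j, w⟩⟩
    · exact absurd rfl h1
    · exact absurd rfl hu
    · exact ⟨j, rfl⟩
  · rintro ⟨j, rfl⟩
    exact isParent_child hu j

theorem letter_of_isParent {u v : Vertex d k} (hu : u ≠ root) (h : IsParent u v) :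
    v.letter = u.letter := by
  obtain ⟨j, rfl⟩ := (isParent_iff_child hu).1 h
  simp

theorem exists_eq_descend {n : ℕ} (hn : n ≠ 0) {v : Vertex d k} (hv : n ≤ v.level) :
    ∃ w u, u.level = n ∧ v = descend w u := by
  obtain _ | ⟨i, u⟩ := v
  · simp [level] at hv; omega
  · simp only [level] at hv
    refine ⟨u.take (u.length + 1 - n), node i (u.drop (u.length + 1 - n)), ?_, ?_⟩
    · simp [level]; omega
    · simp [descend]

theorem exists_letter_level (o : Fin d) (i : Fin k) {n : ℕ} (hn : n ≠ 0) :
    ∃ v : Vertex d k, v.letter = some i ∧ v.level = n :=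
  ⟨node i (List.replicate (n - 1) o), rfl, by simp [level]; omega⟩

/-- Equality in the Neretin group holds only up to finitely many vertices. Going down along one
letter reaches, inside any given cone, a vertex where finitely many such conditions hold together.
-/
theorem tendsto_descend_replicate (o : Fin d) {v : Vertex d k} (hv : v ≠ root) :
    Tendsto (fun r => descend (List.replicate r o) v) atTop cofinite := by
  rw [← Nat.cofinite_eq_atTop]
  refine Function.Injective.tendsto_cofinite fun m n h => ?_
  simpa using congrArg List.length (descend_left_injective hv h)

/-- The action of a map on the words below level `n`, by acting on the prefix. -/
def extendAux (n : ℕ) (f : Vertex d k → Vertex d k) (i : Fin k) : List (Fin d) → Vertex d k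
  | [] => f (node i [])
  -- The vertex `node i (j :: w)` has level `w.length + 2`.
  | j :: w => if w.length + 2 ≤ n then f (node i (j :: w)) else child j (extendAux n f i w)

/-- The map that agrees with `f` up to level `n` and acts on the prefix of length `n` of the
vertices of a higher level. -/
def extend (n : ℕ) (f : Vertex d k → Vertex d k) : Vertex d k → Vertex d k
  | root => f root
  | node i w => extendAux n f i w

theorem extend_of_le {n : ℕ} (f : Vertex d k → Vertex d k) {v : Vertex d k} (hv : v.level ≤ n) :
    extend n f v = f v := by
  rcases v with _ | ⟨i, _ | ⟨j, w⟩⟩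
  · rfl
  · rfl
  · exact if_pos hv

theorem extend_child {n : ℕ} (f : Vertex d k → Vertex d k) {v : Vertex d k} (h0 : v ≠ root)
    (hv : n ≤ v.level) (j : Fin d) : extend n f (child j v) = child j (extend n f v) := by
  cases v
  · exact absurd rfl h0
  · simp only [level] at hv
    exact if_neg (by omega)

theorem extend_descend {n : ℕ} (f : Vertex d k → Vertex d k) {v : Vertex d k} (h0 : v ≠ root)
    (hv : n ≤ v.level) (w : List (Fin d)) :
    extend n f (descend w v) = descend w (extend n f v) := by
  induction w with
  | nil => simp
  | cons j w ih =>
    rw [descend_cons, descend_cons,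
      extend_child f (descend_ne_root h0 w) (hv.trans (level_le_level_descend v w)), ih]

theorem level_extend {n : ℕ} (hn : n ≠ 0) {f : Vertex d k → Vertex d k}
    (hf : ∀ v, (f v).level = v.level) (v : Vertex d k) : (extend n f v).level = v.level := by
  rcases le_total v.level n with h | h
  · rw [extend_of_le f h, hf]
  · obtain ⟨w, u, rfl, rfl⟩ := exists_eq_descend hn h
    have hu : u ≠ root := fun h => hn (level_eq_zero.2 h)
    rw [extend_descend f hu le_rfl, extend_of_le f le_rfl, level_descend hu,
      level_descend (ne_root_of_level_eq hu (hf u).symm), hf]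

theorem extend_extend {n : ℕ} (hn : n ≠ 0) {f : Vertex d k → Vertex d k}
    (hf : ∀ v, (f v).level = v.level) (hff : ∀ v, f (f v) = v) (v : Vertex d k) :
    extend n f (extend n f v) = v := by
  rcases le_total v.level n with h | h
  · rw [extend_of_le f h, extend_of_le f (by rwa [hf]), hff]
  · obtain ⟨w, u, rfl, rfl⟩ := exists_eq_descend hn h
    have hu : u ≠ root := fun h => hn (level_eq_zero.2 h)
    rw [extend_descend f hu le_rfl, extend_of_le f le_rfl,
      extend_descend f (ne_root_of_level_eq hu (hf u).symm) (hf u).ge,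
      extend_of_le f (hf u).le, hff]

/-- Up to level `n` the map `f` is only a level-preserving involution and may break adjacency, hence
the bound on `u`. Below that level children go to children by construction, and the involution gives
the converse. -/
theorem isParent_extend {n : ℕ} (hn : n ≠ 0) {f : Vertex d k → Vertex d k}
    (hf : ∀ v, (f v).level = v.level) (hff : ∀ v, f (f v) = v) {u v : Vertex d k}
    (hu : n ≤ u.level) : IsParent (extend n f u) (extend n f v) ↔ IsParent u v := by
  have key : ∀ u v : Vertex d k, n ≤ u.level → IsParent u v →
      IsParent (extend n f u) (extend n f v) := by
    intro u v hu h
    have h0 : u ≠ root := fun h => hn (by have := level_eq_zero.2 h; omega)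
    obtain ⟨j, rfl⟩ := (isParent_iff_child h0).1 h
    rw [extend_child f h0 hu]
    exact isParent_child (ne_root_of_level_eq h0 (level_extend hn hf u).symm) j
  refine ⟨fun h => ?_, key u v hu⟩
  have := key _ _ (by rwa [level_extend hn hf]) h
  rwa [extend_extend hn hf hff, extend_extend hn hf hff] at this

open Classical in
/-- The transposition of the cones of two vertices of the same level. -/
def swapCones (x y : Vertex d k) : Vertex d k → Vertex d k := extend x.level (Equiv.swap x y)

open Classical in
theorem level_swap {x y : Vertex d k} (h : x.level = y.level)
    (v : Vertex d k) : (Equiv.swap x y v).level = v.level := by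
  rw [Equiv.swap_apply_def]
  split_ifs with h1 h2
  · rw [h1, h]
  · rw [h2, h]
  · rfl

theorem swapCones_left {x y : Vertex d k} (hx : x ≠ root) (w : List (Fin d)) :
    swapCones x y (descend w x) = descend w y := by
  classical
  rw [swapCones, extend_descend _ hx le_rfl, extend_of_le _ le_rfl, Equiv.swap_apply_left]

theorem level_swapCones {x y : Vertex d k} (hx : x ≠ root) (h : x.level = y.level)
    (v : Vertex d k) : (swapCones x y v).level = v.level :=
  level_extend (fun h0 => hx (level_eq_zero.1 h0)) (level_swap h) v

theorem swapCones_swapCones {x y : Vertex d k} (hx : x ≠ root) (h : x.level = y.level)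
    (v : Vertex d k) : swapCones x y (swapCones x y v) = v :=
  extend_extend (fun h0 => hx (level_eq_zero.1 h0)) (level_swap h) (by simp) v

theorem swapCones_of_ne {x y : Vertex d k} (hx : x ≠ root)
    {z : Vertex d k} (hz : z.level = x.level) (hzx : z ≠ x) (hzy : z ≠ y)
    (w : List (Fin d)) : swapCones x y (descend w z) = descend w z := by
  classical
  rw [swapCones, extend_descend _ (ne_root_of_level_eq hx hz.symm) hz.ge, extend_of_le _ hz.le,
    Equiv.swap_apply_of_ne_of_ne hzx hzy]

theorem swapCones_of_letter_ne {x y : Vertex d k} (hx : x ≠ root) (hl : x.letter = y.letter)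
    {v : Vertex d k} (hv : v.letter ≠ x.letter) : swapCones x y v = v := by
  classical
  have key : ∀ u : Vertex d k, u.letter ≠ x.letter → u ≠ x ∧ u ≠ y :=
    fun u hu => ⟨fun h => hu (h ▸ rfl), fun h => hu (h ▸ hl.symm)⟩
  rcases le_total v.level x.level with h1 | h1
  · rw [swapCones, extend_of_le _ h1, Equiv.swap_apply_of_ne_of_ne (key v hv).1 (key v hv).2]
  · obtain ⟨w, u, hu, rfl⟩ := exists_eq_descend (fun h0 => hx (level_eq_zero.1 h0)) h1
    rw [letter_descend] at hv
    exact swapCones_of_ne hx hu (key u hv).1 (key u hv).2 w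

theorem isParent_swapCones {x y : Vertex d k} (hx : x ≠ root) (h : x.level = y.level)
    {u v : Vertex d k} (hu : x.level ≤ u.level) :
    IsParent (swapCones x y u) (swapCones x y v) ↔ IsParent u v :=
  isParent_extend (fun h0 => hx (level_eq_zero.1 h0)) (level_swap h) (by simp) hu

end Vertex

open Vertex

theorem mem_ball {n : ℕ} {v : Vertex d k} : v ∈ (Subtree.ball d k n).verts ↔ v.level ≤ n := Iff.rfl

/-! ### Transpositions of cones as almost automorphisms; almost automorphisms on cones -/

namespace AlmostAut

/-- The almost automorphism that transposes the cones of two vertices of the same level. -/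
def swapCones {x y : Vertex d k} (hx : x ≠ root) (h : x.level = y.level) : AlmostAut d k :=
  have hA : ∀ v ∉ (Subtree.ball d k (x.level - 1)).verts,
      Vertex.swapCones x y v ∉ (Subtree.ball d k (x.level - 1)).verts := fun v hv => by
    rwa [mem_ball, level_swapCones hx h, ← mem_ball]
  -- Removing the ball of this radius makes the vertices of level `x.level` the roots of the
  -- remaining forest, so they can be permuted freely.
  ofMaps (Subtree.ball d k (x.level - 1)) (Subtree.ball d k (x.level - 1))
    (Vertex.swapCones x y) (Vertex.swapCones x y) hA hA
    (fun v _ => swapCones_swapCones hx h v) (fun v _ => swapCones_swapCones hx h v)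
    (fun u hu v _ => isParent_swapCones hx h (by rw [mem_ball] at hu; omega))

theorem ext_swapCones {x y : Vertex d k} (hx : x ≠ root) (h : x.level = y.level) :
    (swapCones hx h).ext =ᶠ[cofinite] Vertex.swapCones x y := by
  filter_upwards [(swapCones hx h).A.finite.compl_mem_cofinite] with v hv
  exact ext_of_notMem _ hv

theorem ext_ne_root (a : AlmostAut d k) {v : Vertex d k} (hv : v ∉ a.A.verts) :
    a.ext v ≠ root := fun h => a.ext_notMem hv (h ▸ a.B.root_mem)

theorem ne_root_of_notMem {A : Subtree d k} {v : Vertex d k} (hv : v ∉ A.verts) : v ≠ root :=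
  fun h => hv (h ▸ A.root_mem)

theorem descend_notMem {A : Subtree d k} {v : Vertex d k} (hv : v ∉ A.verts) (w : List (Fin d)) :
    descend w v ∉ A.verts := by
  induction w with
  | nil => simpa
  | cons j w ih =>
    intro h
    rw [descend_cons] at h
    have := A.parent_mem _ h
    rw [(isParent_child (ne_root_of_notMem ih) j).2] at this
    exact ih this

/-- Outside `A` an almost automorphism is rigid on cones: information on the level or first letter
of the image of a deep vertex passes up to the top of the cone. -/
theorem level_letter_ext_descend (a : AlmostAut d k) {v : Vertex d k} (hv : v ∉ a.A.verts)
    (w : List (Fin d)) : (a.ext (descend w v)).level = (a.ext v).level + w.length ∧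
      (a.ext (descend w v)).letter = (a.ext v).letter := by
  induction w with
  | nil => simp
  | cons j w ih =>
    have h := descend_notMem hv w
    have h1 : IsParent (a.ext (descend w v)) (a.ext (descend (j :: w) v)) :=
      (a.isParent_ext h (descend_notMem hv _)).2 (by
        rw [descend_cons]; exact isParent_child (ne_root_of_notMem h) j)
    refine ⟨?_, (letter_of_isParent (a.ext_ne_root h) h1).trans ih.2⟩
    rw [h1.level, ih.1, List.length_cons]; omega

end AlmostAut

end Neretin

/-! ### Levels and first letters under almost automorphisms -/

namespace Neretin

variable {d k : ℕ}

theorem Vertex.exists_letter_notMem (o : Fin d) {s : Set (Vertex d k)} (hs : s.Finite)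
    (i : Fin k) : ∃ v ∉ s, v.letter = some i := by
  obtain ⟨n, hn⟩ := exists_level_bound hs
  obtain ⟨v, hv, hl⟩ := exists_letter_level o i (Nat.succ_ne_zero n)
  exact ⟨v, fun h => by have := hn v h; omega, hv⟩

theorem Vertex.letter_eq_some {v : Vertex d k} (hv : v ≠ root) : ∃ i, v.letter = some i := by
  cases v
  · exact absurd rfl hv
  · exact ⟨_, rfl⟩

theorem Subtree.compl_mem_cofinite (A : Subtree d k) : ∀ᶠ v in cofinite, v ∉ A.verts :=
  A.finite.compl_mem_cofinite

namespace AlmostAut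

theorem ext_ext_inv_eventually (a : AlmostAut d k) :
    ∀ᶠ w in cofinite, a.ext (a.inv.ext w) = w := by
  filter_upwards [a.B.compl_mem_cofinite] with w hw
  exact a.ext_ext_inv hw

/-- Restriction of an almost automorphism that preserves the level to the complement of a ball. -/
theorem exists_ball (a : AlmostAut d k) {n : ℕ} (hA : ∀ v ∈ a.A.verts, v.level ≤ n)
    (hB : ∀ v ∈ a.B.verts, v.level ≤ n) (h : ∀ v, n < v.level → (a.ext v).level = v.level)
    (h' : ∀ v, n < v.level → (a.inv.ext v).level = v.level) :
    ∃ b : AlmostAut d k, b.A = Subtree.ball d k n ∧ b.B = Subtree.ball d k n ∧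
      NeretinGroup.mk b = NeretinGroup.mk a := by
  have hA' : ∀ v ∉ (Subtree.ball d k n).verts, v ∉ a.A.verts := fun v hv h => hv (hA v h)
  have hB' : ∀ v ∉ (Subtree.ball d k n).verts, v ∉ a.B.verts := fun v hv h => hv (hB v h)
  let b : AlmostAut d k := ofMaps (Subtree.ball d k n) (Subtree.ball d k n) a.ext a.inv.ext
    (fun v hv => by rw [mem_ball] at hv ⊢; rwa [h v (not_le.1 hv)])
    (fun v hv => by rw [mem_ball] at hv ⊢; rwa [h' v (not_le.1 hv)])
    (fun v hv => a.ext_inv_ext (hA' v hv)) (fun v hv => a.ext_ext_inv (hB' v hv))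
    (fun u hu v hv => a.isParent_ext (hA' u hu) (hA' v hv))
  refine ⟨b, rfl, rfl, NeretinGroup.mk_eq_mk.2 ?_⟩
  filter_upwards [b.A.compl_mem_cofinite] with v hv
  exact ext_of_notMem _ hv

/-- Membership in `O` becomes a condition with finitely many exceptions. Conversely, choose a ball
containing `A`, `B` and the exceptional vertices of both the map and its inverse; its complement is
then preserved. -/
theorem mk_mem_ballSubgroup_iff {a : AlmostAut d k} :
    NeretinGroup.mk a ∈ NeretinGroup.ballSubgroup d k ↔
      ∀ᶠ v in cofinite, (a.ext v).level = v.level := by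
  constructor
  · rintro ⟨b, n, hA, hB, h⟩
    filter_upwards [NeretinGroup.mk_eq_mk.1 h, b.A.compl_mem_cofinite] with v hv hb
    rw [← hv, NeretinGroup.level_ext_of_ball hA hB v hb]
  · intro h
    have h' : ∀ᶠ v in cofinite, (a.inv.ext v).level = v.level := by
      filter_upwards [a.inv.tendsto_ext.eventually h, a.ext_ext_inv_eventually] with v h1 h2
      rw [← h1, h2]
    obtain ⟨n, hn⟩ := exists_level_bound (((a.A.finite.union a.B.finite).union
      (eventually_cofinite.1 h)).union (eventually_cofinite.1 h'))
    obtain ⟨b, hA, hB, hb⟩ := a.exists_ball (n := n) (fun v hv => hn v (.inl (.inl (.inl hv))))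
      (fun v hv => hn v (.inl (.inl (.inr hv))))
      (fun v hv => by_contra fun h0 => absurd (hn v (.inl (.inr h0))) (not_le.2 hv))
      (fun v hv => by_contra fun h0 => absurd (hn v (.inr h0)) (not_le.2 hv))
    exact ⟨b, n, hA, hB, hb⟩

theorem mk_swapCones_mem_ballSubgroup {x y : Vertex d k} (hx : x ≠ root)
    (h : x.level = y.level) :
    NeretinGroup.mk (swapCones hx h) ∈ NeretinGroup.ballSubgroup d k :=
  ⟨_, _, rfl, rfl, rfl⟩

theorem inv_mk_swapCones {x y : Vertex d k} (hx : x ≠ root) (h : x.level = y.level) :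
    (NeretinGroup.mk (swapCones hx h))⁻¹ = NeretinGroup.mk (swapCones hx h) := rfl

/-- If `κ φ = φ s t`, where `s` and `t` transpose the cones of vertices at two different depths
below `x` and `y`, then a function preserved by `κ` cannot distinguish the images of `x` and `y`
under `φ`. -/
theorem exists_descend_eq {β : Type*} {F : Vertex d k → β} (a : AlmostAut d k) {o e : Fin d}
    (hoe : o ≠ e) {x y : Vertex d k} (hx : x ≠ root) (hy : y ≠ root) {m n : ℕ} (hmn : m < n)
    {s t c : AlmostAut d k}
    (hs : s.ext =ᶠ[cofinite] Vertex.swapCones (descend (List.replicate m o) x)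
      (descend (List.replicate m o) y))
    (ht : t.ext =ᶠ[cofinite] Vertex.swapCones (descend (List.replicate n o) x)
      (descend (List.replicate n o) y))
    (hc : NeretinGroup.mk c * NeretinGroup.mk a =
      NeretinGroup.mk a * (NeretinGroup.mk s * NeretinGroup.mk t))
    (hF : ∀ᶠ v in cofinite, F (c.ext v) = F v) :
    ∃ w, F (a.ext (descend w x)) = F (a.ext (descend w y)) := by
  by_cases hxy : x = y
  · exact ⟨[], by rw [hxy]⟩
  have hc' : ∀ᶠ v in cofinite, c.ext (a.ext v) = a.ext (s.ext (t.ext v)) := by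
    filter_upwards [c.ext_comp a, a.ext_comp (s.comp t), s.ext_comp t,
      NeretinGroup.mk_eq_mk.1 hc] with v h1 h2 h3 h4
    rw [← h1, h4, h2, h3]
  -- Words are read from the right: from `x` the path is `m` times `o`, then `e`, then `o` up to
  -- depth `n`. It stays inside the cone moved by `s` and, by its letter `e`, leaves the path to the
  -- cone moved by `t`.
  set l := List.replicate (n - m - 1) o ++ [e] with hl
  have hlen : (l ++ List.replicate m o).length = n := by simp [hl]; omega
  set z := descend (l ++ List.replicate m o) x with hz
  have hne : ∀ y : Vertex d k, y ≠ root → z = descend (List.replicate n o) y →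
      (l ++ List.replicate m o = List.replicate n o ∧ x = y) := fun y hy h =>
    descend_right_injective (by simpa using hlen) hx hy h
  have hzx : z ≠ descend (List.replicate n o) x := fun h => by
    have h1 := (hne x hx h).1
    have h2 : e ∈ List.replicate n o := by rw [← h1]; simp [hl]
    exact hoe (List.eq_of_mem_replicate h2).symm
  have hzy : z ≠ descend (List.replicate n o) y := fun h => hxy (hne y hy h).2
  -- Far below `z` all the eventual identities hold. There `t` is trivial and `s` passes from `x` to
  -- `y`, so `c` takes the image under `a` of a vertex below `x` to that of the corresponding vertex
  -- below `y`.
  obtain ⟨r, h1, h2, h3, h4⟩ := ((tendsto_descend_replicate o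
    (descend_ne_root hx (l ++ List.replicate m o))).eventually
      (hc'.and (ht.and (hs.and (a.tendsto_ext.eventually hF))))).exists
  rw [h2, swapCones_of_ne (descend_ne_root hx _)
    (by rw [level_descend hx, level_descend hx, hlen, List.length_replicate]) hzx hzy, h3] at h1
  have h5 : descend (List.replicate r o) (descend (l ++ List.replicate m o) x) =
      descend (List.replicate r o ++ l) (descend (List.replicate m o) x) := by
    simp only [descend_append]
  rw [h5] at h1 h4
  rw [swapCones_left (descend_ne_root hx _)] at h1
  rw [h1, ← descend_append, ← descend_append] at h4
  exact ⟨_, h4.symm⟩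

/-- A symmetric relation compatible with descending holds for all vertices if it holds for
vertices of the same level. -/
theorem rel_of_level_eq {A : Subtree d k} (o : Fin d) {p : Option (Fin k) → Prop}
    {R : Vertex d k → Vertex d k → Prop} (hsymm : ∀ x y, R x y → R y x)
    (hstep : ∀ x ∉ A.verts, ∀ w y, R (descend w x) y → R x y)
    (h : ∀ x ∉ A.verts, ∀ y ∉ A.verts, p x.letter → p y.letter → x.level = y.level → R x y)
    {x y : Vertex d k} (hx : x ∉ A.verts) (hy : y ∉ A.verts) (hpx : p x.letter)
    (hpy : p y.letter) : R x y := by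
  -- The higher of the two vertices is replaced by a descendant at the level of the other.
  have key : ∀ x ∉ A.verts, ∀ y ∉ A.verts, p x.letter → p y.letter → x.level ≤ y.level →
      R x y := by
    intro x hx y hy hpx hpy hl
    refine hstep x hx (List.replicate (y.level - x.level) o) y
      (h _ (descend_notMem hx _) y hy (by simpa) hpy ?_)
    rw [level_descend (ne_root_of_notMem hx), List.length_replicate]; omega
  rcases le_total x.level y.level with hl | hl
  · exact key x hx y hy hpx hpy hl
  · exact hsymm _ _ (key y hy x hx hpy hpx hl)

/-- If an almost automorphism maps vertices with the same first letter to vertices with the same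
first letter, then it permutes the first letters. -/
theorem exists_perm_letter (o : Fin d) (a : AlmostAut d k)
    (h : ∀ x ∉ a.A.verts, ∀ y ∉ a.A.verts, x.letter = y.letter →
      (a.ext x).letter = (a.ext y).letter) :
    ∃ π : Equiv.Perm (Fin k), ∀ v ∉ a.A.verts, (a.ext v).letter = v.letter.map π := by
  have h1 : ∀ i : Fin k, ∃ j : Fin k, ∀ v ∉ a.A.verts, v.letter = some i →
      (a.ext v).letter = some j := by
    intro i
    obtain ⟨v, hv, hi⟩ := exists_letter_notMem o a.A.finite i
    obtain ⟨j, hj⟩ := letter_eq_some (a.ext_ne_root hv)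
    exact ⟨j, fun u hu hui => (h u hu v hv (hui.trans hi.symm)).trans hj⟩
  choose f hf using h1
  -- Every letter occurs outside `B`, and such a vertex is an image under `a`.
  have hsurj : Function.Surjective f := by
    intro j
    obtain ⟨w, hw, hj⟩ := exists_letter_notMem o a.B.finite j
    obtain ⟨i, hi⟩ := letter_eq_some (a.inv.ext_ne_root hw)
    have h2 := hf i _ (a.ext_inv_notMem hw) hi
    rw [a.ext_ext_inv hw, hj] at h2
    exact ⟨i, (Option.some_injective _ h2).symm⟩
  refine ⟨Equiv.ofBijective f ⟨Finite.injective_iff_surjective.2 hsurj, hsurj⟩, fun v hv => ?_⟩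
  obtain ⟨i, hi⟩ := letter_eq_some (ne_root_of_notMem hv)
  rw [hf i v hv hi, hi]
  rfl

/-- An almost automorphism that shifts the level by a constant on sufficiently many vertices does
not decrease it. -/
theorem shift_nonneg (hd : 2 ≤ d) (a : AlmostAut d k) {S T : Finset (Fin k)}
    (hS : S.Nonempty) (hST : S.card = T.card) {c : ℤ}
    (h : ∀ᶠ v in cofinite, ∀ i ∈ S, v.letter = some i →
      (∃ j ∈ T, (a.ext v).letter = some j) ∧ ((a.ext v).level : ℤ) = v.level + c) : 0 ≤ c := by
  obtain ⟨n, hn⟩ := exists_level_bound (a.A.finite.union (eventually_cofinite.1 h))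
  -- Positivity of `n` guarantees that the truncated `(n + c).toNat` is still smaller than `n` when
  -- `c < 0`.
  obtain ⟨n, hn, hn0⟩ : ∃ m, (∀ v ∈ a.A.verts ∪ _, v.level ≤ m) ∧ 0 < m :=
    ⟨n + 1, fun v hv => (hn v hv).trans n.le_succ, n.succ_pos⟩
  have hout : ∀ v : Vertex d k, n < v.level → v ∉ a.A.verts :=
    fun v hv h0 => absurd (hn v (.inl h0)) (not_le.2 hv)
  have hv : ∀ v : Vertex d k, n < v.level → ∀ i ∈ S, v.letter = some i →
      (∃ j ∈ T, (a.ext v).letter = some j) ∧ ((a.ext v).level : ℤ) = v.level + c :=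
    fun v hv => by_contra fun h0 => absurd (hn v (.inr h0)) (not_le.2 hv)
  by_contra! hc
  -- If `c < 0`, the `|S| * d ^ n` vertices of level `n + 1` with first letter in `S` would inject
  -- into `|T| * d ^ (n + c)` vertices, contradicting `|S| = |T|` and `d ≥ 2`.
  have key : ∀ p : S × List.Vector (Fin d) n, ∃ q : T × List.Vector (Fin d) ((n : ℤ) + c).toNat,
      a.ext (node p.1.1 p.2.1) = node q.1.1 q.2.1 := by
    rintro ⟨⟨i, hi⟩, ⟨w, hw⟩⟩
    obtain ⟨⟨j, hj, hj'⟩, hl⟩ := hv (node i w) (by simp [level, hw]) i hi rfl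
    rcases hu : a.ext (node i w) with _ | ⟨j', u⟩
    · rw [hu] at hj'; simp [letter] at hj'
    · rw [hu] at hj' hl
      obtain rfl : j' = j := by simpa [letter] using hj'
      simp only [level, hw, Nat.cast_add, Nat.cast_one] at hl
      exact ⟨⟨⟨j', hj⟩, ⟨u, by omega⟩⟩, rfl⟩
  choose f hf using key
  have hinj : Function.Injective f := by
    intro p q hpq
    have h1 : a.ext (node p.1.1 p.2.1) = a.ext (node q.1.1 q.2.1) := by rw [hf, hf, hpq]
    have hp := hout (node p.1.1 p.2.1) (by simp [level])
    have hq := hout (node q.1.1 q.2.1) (by simp [level])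
    have h2 := (a.ext_inv_ext hp).symm.trans ((congrArg a.inv.ext h1).trans (a.ext_inv_ext hq))
    rw [node.injEq] at h2
    exact Prod.ext (Subtype.ext h2.1) (Subtype.ext h2.2)
  have hcard := Fintype.card_le_of_injective f hinj
  simp only [Fintype.card_prod, Fintype.card_coe, card_vector, Fintype.card_fin, hST] at hcard
  have hpos : 0 < T.card := hST ▸ hS.card_pos
  have h1 := (Nat.pow_le_pow_iff_right (by omega : 1 < d)).1 (Nat.le_of_mul_le_mul_left hcard hpos)
  omega

end AlmostAut

end Neretin

/-! ### Ends and their first letters -/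

namespace Ends

variable {d k : ℕ}

theorem ray_ne_root (ξ : Ends d k) (n : ℕ) : ξ.ray (n + 1) ≠ root := (ξ.isParent n).1

theorem letter_ray (ξ : Ends d k) {n : ℕ} (hn : n ≠ 0) :
    (ξ.ray n).letter = (ξ.ray 1).letter := by
  obtain ⟨n, rfl⟩ := Nat.exists_eq_succ_of_ne_zero hn
  induction n with
  | zero => rfl
  | succ n ih =>
    rw [Nat.succ_eq_add_one, letter_of_isParent (ray_ne_root ξ n) (ξ.isParent (n + 1))]
    exact ih (Nat.succ_ne_zero n)

theorem mem_through_iff {ξ : Ends d k} {i : Fin k} :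
    ξ ∈ through (node i []) ↔ (ξ.ray 1).letter = some i := by
  constructor
  · rintro ⟨n, hn⟩
    have h : n ≠ 0 := by
      rintro rfl
      rw [ξ.ray_zero] at hn
      cases hn
    rw [← letter_ray ξ h, hn]
    rfl
  · intro h
    refine ⟨1, ?_⟩
    have h1 := level_apply ξ 1
    rcases hv : ξ.ray 1 with _ | ⟨j, w⟩
    · rw [hv] at h; cases h
    · rw [hv] at h h1
      simp only [letter, Option.some.injEq, level] at h h1
      rw [h, List.eq_nil_of_length_eq_zero (by omega : w.length = 0)]

theorem exists_ray_eq_descend (ξ : Ends d k) {n : ℕ} (hn : n ≠ 0) (m : ℕ) :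
    ∃ w, ξ.ray (n + m) = descend w (ξ.ray n) := by
  induction m with
  | zero => exact ⟨[], by simp⟩
  | succ m ih =>
    obtain ⟨w, hw⟩ := ih
    obtain ⟨j, hj⟩ := (isParent_iff_child (fun h => by
      have := level_apply ξ (n + m); rw [h] at this; simp [level] at this; omega)).1
        (ξ.isParent (n + m))
    exact ⟨j :: w, by rw [← Nat.add_assoc, hj, hw, descend_cons]⟩

theorem exists_ray_eq (o : Fin d) {v : Vertex d k} (hv : v ≠ root) :
    ∃ (ξ : Ends d k) (n : ℕ), n ≠ 0 ∧ ξ.ray n = v := by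
  have hit : ∀ (j : ℕ) (v : Vertex d k), (parent^[j] v).level = v.level - j := by
    intro j
    induction j with
    | zero => intro v; rfl
    | succ j ih => intro v; rw [Function.iterate_succ_apply, ih, level_parent]; omega
  have hpar : ∀ n, parent (descend (List.replicate (n + 1) o) v) =
      descend (List.replicate n o) v := fun n => by
    rw [List.replicate_succ, descend_cons]
    exact (isParent_child (descend_ne_root hv _) o).2
  -- Continue `v` forever by the letter `o` and truncate to level `n`: from `n` steps below `v`, go
  -- back `v.level` steps.
  let x : ℕ → Vertex d k := fun n => parent^[v.level] (descend (List.replicate n o) v)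
  have hx : ∀ n, (x n).level = n := fun n => by
    change (parent^[v.level] _).level = n
    rw [hit, level_descend hv, List.length_replicate]; omega
  refine ⟨⟨x, level_eq_zero.1 (hx 0), fun n => ⟨fun h => ?_, ?_⟩⟩, v.level,
    fun h => hv (level_eq_zero.1 h), ?_⟩
  · have := hx (n + 1)
    rw [h] at this
    simp [level] at this
  · change parent (parent^[v.level] _) = parent^[v.level] _
    rw [← Function.iterate_succ_apply' parent, Function.iterate_succ_apply, hpar]
  · change parent^[v.level] _ = v
    generalize v.level = n
    induction n with
    | zero => simp
    | succ n ih => rw [Function.iterate_succ_apply, hpar, ih]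

theorem smul_eq_of_maps {a : AlmostAut d k} {ξ η : Ends d k} (h : Maps a.ext ξ η) :
    NeretinGroup.mk a • ξ = η := (map_spec a ξ).unique h

/-- Translates between fixing ends and preserving first letters of vertices: the tail of `ξ` beyond
any vertex outside `A` stays in one cone, and so does its image. -/
theorem letter_smul (a : AlmostAut d k) (ξ : Ends d k) {n : ℕ} (hn : ξ.ray n ∉ a.A.verts) :
    ((NeretinGroup.mk a • ξ).ray 1).letter = (a.ext (ξ.ray n)).letter := by
  have hn0 : n ≠ 0 := fun h => hn (by rw [h, ξ.ray_zero]; exact a.A.root_mem)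
  obtain ⟨m, h, hm⟩ := ((map_spec a ξ).and (eventually_ge_atTop n)).exists
  obtain ⟨j, rfl⟩ := Nat.exists_eq_add_of_le hm
  obtain ⟨w, hw⟩ := exists_ray_eq_descend ξ hn0 j
  rw [← (a.level_letter_ext_descend hn w).2, ← hw, h]
  refine (letter_ray _ fun h0 => ?_).symm
  rw [hw] at h0
  exact a.ext_ne_root (AlmostAut.descend_notMem hn w) (level_eq_zero.1 h0)

end Ends

/-! ### The subgroups `P` and `O'` described by first letters -/

namespace NeretinGroup

variable {d k : ℕ}

theorem mk_swapCones_mem_levelOneProduct {x y : Vertex d k} (hx : x ≠ root)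
    (h : x.level = y.level) (hl : x.letter = y.letter) :
    mk (AlmostAut.swapCones hx h) ∈ levelOneProduct d k := by
  obtain ⟨i, hi⟩ := letter_eq_some hx
  refine Subgroup.mem_iSup_of_mem i ⟨AlmostAut.mk_swapCones_mem_ballSubgroup hx h, ?_⟩
  refine (mem_fixingSubgroup_iff _).2 fun ξ hξ => Ends.smul_eq_of_maps ?_
  rw [Set.mem_compl_iff, Ends.mem_through_iff] at hξ
  filter_upwards [ξ.tendsto_cofinite.eventually (AlmostAut.ext_swapCones hx h),
    eventually_ne_atTop 0] with n hn hn0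
  rw [hn, swapCones_of_letter_ne hx hl (by rwa [Ends.letter_ray ξ hn0, hi]), Ends.level_apply]

/-- Vertices with a letter other than `i` lie on fixed ends. A vertex with letter `i` cannot acquire
another letter, since the inverse also lies in the rigid stabilizer and would preserve that other
letter. -/
theorem letter_eq_of_mem_rigidStabilizer (o : Fin d) {i : Fin k} {a : AlmostAut d k}
    (ha : mk a ∈ rigidStabilizer (ballSubgroup d k) (Ends.through (node i []))) {v : Vertex d k}
    (hv : v ∉ a.A.verts) : (a.ext v).letter = v.letter := by
  have key : ∀ {a : AlmostAut d k} {v : Vertex d k},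
      mk a ∈ rigidStabilizer (ballSubgroup d k) (Ends.through (node i [])) →
      v ∉ a.A.verts → v.letter ≠ some i → (a.ext v).letter = v.letter := by
    intro a v ha hv hi
    obtain ⟨ξ, n, hn, rfl⟩ := Ends.exists_ray_eq o (AlmostAut.ne_root_of_notMem hv)
    have h1 : mk a • ξ = ξ := (mem_fixingSubgroup_iff _).1 ha.2 ξ (by
      rwa [Set.mem_compl_iff, Ends.mem_through_iff, ← Ends.letter_ray ξ hn])
    rw [← Ends.letter_smul a ξ hv, h1, Ends.letter_ray ξ hn]
  by_cases hi : v.letter = some i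
  · by_contra hne
    have h := key (a := a.inv) (v := a.ext v) (inv_mem ha) (a.ext_notMem hv)
      (fun h => hne (h.trans hi.symm))
    rw [a.ext_inv_ext hv] at h
    exact hne h.symm
  · exact key ha hv hi

/-- The subgroup of the elements that preserve the first letter of all but finitely many
vertices. -/
def letterStabilizer (d k : ℕ) : Subgroup (NeretinGroup d k) where
  carrier := {g | ∃ a, mk a = g ∧ ∀ᶠ v in cofinite, (a.ext v).letter = v.letter}
  one_mem' := ⟨AlmostAut.ofAut 1, rfl, Eventually.of_forall fun v => by
    rw [AlmostAut.ext_ofAut]; rfl⟩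
  inv_mem' := by
    rintro _ ⟨a, rfl, ha⟩
    refine ⟨a.inv, rfl, ?_⟩
    filter_upwards [a.inv.tendsto_ext.eventually ha, a.ext_ext_inv_eventually] with v h1 h2
    rw [← h1, h2]
  mul_mem' := by
    rintro _ _ ⟨a, rfl, ha⟩ ⟨b, rfl, hb⟩
    refine ⟨a.comp b, rfl, ?_⟩
    filter_upwards [a.ext_comp b, b.tendsto_ext.eventually ha, hb] with v h1 h2 h3
    rw [h1, h2, h3]

theorem mk_mem_letterStabilizer_iff {a : AlmostAut d k} :
    mk a ∈ letterStabilizer d k ↔ ∀ᶠ v in cofinite, (a.ext v).letter = v.letter := by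
  refine ⟨?_, fun h => ⟨a, rfl, h⟩⟩
  rintro ⟨b, hb, h⟩
  filter_upwards [mk_eq_mk.1 hb, h] with v h1 h2
  rw [← h1, h2]

theorem levelOneProduct_le_letterStabilizer (o : Fin d) :
    levelOneProduct d k ≤ letterStabilizer d k := by
  refine iSup_le fun i g hg => ?_
  obtain ⟨a, rfl⟩ := exists_mk g
  refine ⟨a, rfl, ?_⟩
  filter_upwards [a.A.compl_mem_cofinite] with v hv
  exact letter_eq_of_mem_rigidStabilizer o hg hv

theorem levelOneProduct_le_ballSubgroup : levelOneProduct d k ≤ ballSubgroup d k :=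
  iSup_le fun _ => inf_le_left

theorem levelOneProduct_le_levelOneNormalizer :
    levelOneProduct d k ≤ levelOneNormalizer d k :=
  le_inf levelOneProduct_le_ballSubgroup Subgroup.le_normalizer

theorem levelOneNormalizer_le_ballSubgroup : levelOneNormalizer d k ≤ ballSubgroup d k :=
  inf_le_left

/-- It suffices to treat generators: conjugation by `a` carries the rigid stabilizer of the `i`-th
cone into that of the `π i`-th. -/
theorem conj_mem_levelOneProduct {a : AlmostAut d k} (ha : mk a ∈ ballSubgroup d k)
    {π : Equiv.Perm (Fin k)} (hπ : ∀ᶠ v in cofinite, (a.ext v).letter = v.letter.map π)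
    {h : NeretinGroup d k} (hh : h ∈ levelOneProduct d k) :
    mk a * h * (mk a)⁻¹ ∈ levelOneProduct d k := by
  have hsmul : ∀ ξ : Ends d k, ((mk a • ξ).ray 1).letter = (ξ.ray 1).letter.map π := by
    intro ξ
    obtain ⟨n, ⟨h1, h2⟩, hn⟩ := ((ξ.tendsto_cofinite.eventually
      (a.A.compl_mem_cofinite.and hπ)).and (eventually_ne_atTop 0)).exists
    rw [Ends.letter_smul a ξ h1, h2, Ends.letter_ray ξ hn]
  suffices H : levelOneProduct d k ≤
      (levelOneProduct d k).comap (MulAut.conj (mk a)).toMonoidHom from H hh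
  refine iSup_le fun i g hg => Subgroup.mem_comap.2 (Subgroup.mem_iSup_of_mem (π i) ⟨?_, ?_⟩)
  · exact mul_mem (mul_mem ha (Subgroup.mem_inf.1 hg).1) ((ballSubgroup d k).inv_mem ha)
  · refine (mem_fixingSubgroup_iff _).2 fun ξ hξ => ?_
    change (mk a * g * (mk a)⁻¹) • ξ = ξ
    have h1 : g • (mk a)⁻¹ • ξ = (mk a)⁻¹ • ξ := by
      refine (mem_fixingSubgroup_iff _).1 hg.2 _ ?_
      rw [Set.mem_compl_iff, Ends.mem_through_iff] at hξ ⊢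
      intro h0
      have h2 := hsmul ((mk a)⁻¹ • ξ)
      rw [smul_inv_smul, h0] at h2
      exact hξ h2
    rw [mul_smul, mul_smul, h1, smul_inv_smul]

/-- If `a` normalizes `P`, conjugates by `a` of transpositions of two cones with the same first
letter lie in `P`, so they preserve first letters; hence `a` cannot separate the two cones. The
converse is `conj_mem_levelOneProduct` for `a` and its inverse. -/
theorem mk_mem_levelOneNormalizer_iff (o : Fin d) {a : AlmostAut d k} :
    mk a ∈ levelOneNormalizer d k ↔ mk a ∈ ballSubgroup d k ∧
      ∃ π : Equiv.Perm (Fin k), ∀ᶠ v in cofinite, (a.ext v).letter = v.letter.map π := by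
  constructor
  · rintro ⟨h1, h2⟩
    refine ⟨h1, ?_⟩
    suffices H : ∀ x ∉ a.A.verts, ∀ y ∉ a.A.verts, x.letter = y.letter →
        (a.ext x).letter = (a.ext y).letter by
      obtain ⟨π, hπ⟩ := a.exists_perm_letter o H
      exact ⟨π, a.A.compl_mem_cofinite.mono hπ⟩
    intro x hx y hy hxy
    refine AlmostAut.rel_of_level_eq (p := fun l => l = x.letter)
      (R := fun x y => (a.ext x).letter = (a.ext y).letter) o (fun _ _ h => h.symm)
      (fun x hx w y h => by rwa [(a.level_letter_ext_descend hx w).2] at h) ?_ hx hy rfl hxy.symm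
    intro x hx y hy hpx hpy hl
    have hx0 := AlmostAut.ne_root_of_notMem hx
    have hs := (Subgroup.mem_normalizer_iff.1 h2 _).1
      (mk_swapCones_mem_levelOneProduct hx0 hl (hpx.trans hpy.symm))
    obtain ⟨c, hc⟩ := exists_mk (mk a * mk (AlmostAut.swapCones hx0 hl) * (mk a)⁻¹)
    rw [hc] at hs
    have hs' := mk_mem_letterStabilizer_iff.1 (levelOneProduct_le_letterStabilizer o hs)
    have he : mk (c.comp a) = mk (a.comp (AlmostAut.swapCones hx0 hl)) := by
      rw [← mk_mul_mk, ← mk_mul_mk]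
      exact (mul_inv_eq_iff_eq_mul.1 hc).symm
    obtain ⟨r, h3, h4, h5, h6, h7⟩ := ((tendsto_descend_replicate o hx0).eventually
      ((mk_eq_mk.1 he).and ((c.ext_comp a).and ((a.ext_comp (AlmostAut.swapCones hx0 hl)).and
        ((AlmostAut.ext_swapCones hx0 hl).and (a.tendsto_ext.eventually hs')))))).exists
    simp only [h4, h5, h6, swapCones_left hx0] at h3
    rw [h3, (a.level_letter_ext_descend hx _).2, (a.level_letter_ext_descend hy _).2] at h7
    exact h7.symm
  · rintro ⟨h1, π, hπ⟩
    refine ⟨h1, Subgroup.mem_normalizer_iff.2 fun h =>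
      ⟨conj_mem_levelOneProduct h1 hπ, fun hh => ?_⟩⟩
    have hπ' : ∀ᶠ v in cofinite, (a.inv.ext v).letter = v.letter.map (π⁻¹ : Equiv.Perm (Fin k)) := by
      filter_upwards [a.inv.tendsto_ext.eventually hπ, a.ext_ext_inv_eventually] with v h1 h2
      rw [h2] at h1
      simp [h1]
    have := conj_mem_levelOneProduct (a := a.inv) (inv_mem h1) hπ' hh
    rw [← mk_inv] at this
    simpa [mul_assoc] using this

end NeretinGroup

/-! ### Consequences of a finite orbit on a coset space -/

/-- If the `H`-orbit of a coset of `K` is finite, then, along any sequence of elements of `H`, two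
members differ by an element of the conjugate of `Q`, for any subgroup `Q` such that the elements
of `K` in the same coset of `Q` are detected by finitely many colours. -/
theorem Subgroup.exists_lt_conj_mem_of_finite_orbit {G : Type*} [Group G] {H K Q : Subgroup G}
    {γ : Type*} [Finite γ] (col : G → γ)
    (hcol : ∀ x ∈ K, ∀ y ∈ K, col x = col y → x⁻¹ * y ∈ Q) {g : G}
    (hfin : (MulAction.orbit H (QuotientGroup.mk g⁻¹ : G ⧸ K)).Finite) {s : ℕ → G}
    (hs : ∀ m, s m ∈ H) : ∃ m n, m < n ∧ g * ((s m)⁻¹ * s n) * g⁻¹ ∈ Q := by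
  have := hfin.to_subtype
  let c : ℕ → G ⧸ K := fun m => QuotientGroup.mk (s m * g⁻¹)
  -- Dividing by a fixed representative of the coset gives elements of `K`; when the representatives
  -- agree they cancel, so `(κ m)⁻¹ * κ n = g * ((s m)⁻¹ * s n) * g⁻¹`.
  let κ : ℕ → G := fun m => (c m).out⁻¹ * (s m * g⁻¹)
  have hκ : ∀ m, κ m ∈ K := fun m => QuotientGroup.eq.1 (Quotient.out_eq (c m))
  let f : ℕ → MulAction.orbit H (QuotientGroup.mk g⁻¹ : G ⧸ K) × γ :=
    fun m => (⟨c m, ⟨⟨s m, hs m⟩, rfl⟩⟩, col (κ m))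
  have key : ∀ m n, f m = f n → g * ((s m)⁻¹ * s n) * g⁻¹ ∈ Q := by
    intro m n h
    have h1 : c m = c n := congrArg (fun p => p.1.1) h
    have h2 := hcol _ (hκ m) _ (hκ n) (congrArg (fun p => p.2) h)
    simp only [κ, h1] at h2
    convert h2 using 1
    group
  obtain ⟨m, n, hmn, h⟩ := Finite.exists_ne_map_eq_of_infinite f
  rcases lt_or_gt_of_ne hmn with h1 | h1
  · exact ⟨m, n, h1, key m n h⟩
  · exact ⟨n, m, h1, key n m h.symm⟩

namespace Neretin.AlmostAut

variable {d k : ℕ}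

/-- `shift_nonneg` applies to `a` and to its inverse; the equivalence between letters in `S` and in
`T` is what transfers the hypotheses to the inverse. -/
theorem shift_eq_zero (hd : 2 ≤ d) (a : AlmostAut d k) {S T : Finset (Fin k)}
    (hS : S.Nonempty) (hST : S.card = T.card) {c : ℤ}
    (h : ∀ v ∉ a.A.verts, ∀ i j, v.letter = some i → (a.ext v).letter = some j →
      (i ∈ S ↔ j ∈ T))
    (hc : ∀ v ∉ a.A.verts, ∀ i ∈ S, v.letter = some i →
      ((a.ext v).level : ℤ) = v.level + c) : c = 0 := by
  have h1 : 0 ≤ c := by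
    refine a.shift_nonneg hd hS hST ?_
    filter_upwards [a.A.compl_mem_cofinite] with v hv i hi hvi
    obtain ⟨j, hj⟩ := letter_eq_some (a.ext_ne_root hv)
    exact ⟨⟨j, (h v hv i j hvi hj).1 hi, hj⟩, hc v hv i hi hvi⟩
  have h2 : 0 ≤ -c := by
    refine a.inv.shift_nonneg hd (Finset.card_pos.1 (hST ▸ hS.card_pos)) hST.symm ?_
    filter_upwards [a.B.compl_mem_cofinite] with w hw j hj hwj
    have hv := a.ext_inv_notMem hw
    have he := a.ext_ext_inv hw
    obtain ⟨i, hi⟩ := letter_eq_some (a.inv.ext_ne_root hw)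
    have hiS := (h _ hv i j hi (by rwa [he])).2 hj
    have h3 := hc _ hv i hiS hi
    rw [he] at h3
    exact ⟨⟨i, hiS, hi⟩, by omega⟩
  omega

/-- Descending increases the level of a vertex and that of its image equally, so the shift is
constant along cones and need only be compared at equal levels. -/
theorem shift_eq_of_level_eq (o : Fin d) (a : AlmostAut d k) {p : Option (Fin k) → Prop}
    (h : ∀ x ∉ a.A.verts, ∀ y ∉ a.A.verts, p x.letter → p y.letter → x.level = y.level →
      (a.ext x).level = (a.ext y).level)
    {x y : Vertex d k} (hx : x ∉ a.A.verts) (hy : y ∉ a.A.verts) (hpx : p x.letter)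
    (hpy : p y.letter) : ((a.ext x).level : ℤ) - x.level = (a.ext y).level - y.level := by
  refine rel_of_level_eq (p := p)
    (R := fun x y => ((a.ext x).level : ℤ) - x.level = (a.ext y).level - y.level) o
    (fun _ _ h => h.symm) (fun x hx w y h => ?_)
    (fun x hx y hy hpx hpy hl => by rw [h x hx y hy hpx hpy hl, hl]) hx hy hpx hpy
  rw [(a.level_letter_ext_descend hx w).1, level_descend (ne_root_of_notMem hx)] at h
  push_cast at h
  linarith

theorem exists_shift (o : Fin d) (a : AlmostAut d k) {p : Option (Fin k) → Prop}
    (h : ∀ x ∉ a.A.verts, ∀ y ∉ a.A.verts, p x.letter → p y.letter → x.level = y.level →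
      (a.ext x).level = (a.ext y).level) :
    ∃ c : ℤ, ∀ v ∉ a.A.verts, p v.letter → ((a.ext v).level : ℤ) = v.level + c := by
  by_cases hv : ∃ v ∉ a.A.verts, p v.letter
  · obtain ⟨u, hu, hpu⟩ := hv
    refine ⟨(a.ext u).level - u.level, fun v hv hpv => ?_⟩
    have := shift_eq_of_level_eq o a h hv hu hpv hpu
    linarith
  -- No vertex outside `A` satisfies `p`, so any constant would do.
  · exact ⟨0, fun v h1 h2 => absurd ⟨v, h1, h2⟩ hv⟩

theorem letter_eq_of_level_eq (o : Fin d) (a : AlmostAut d k) {p : Option (Fin k) → Prop}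
    (h : ∀ x ∉ a.A.verts, ∀ y ∉ a.A.verts, p x.letter → p y.letter → x.level = y.level →
      (a.ext x).letter = (a.ext y).letter)
    {x y : Vertex d k} (hx : x ∉ a.A.verts) (hy : y ∉ a.A.verts) (hpx : p x.letter)
    (hpy : p y.letter) : (a.ext x).letter = (a.ext y).letter :=
  rel_of_level_eq (p := p) (R := fun x y => (a.ext x).letter = (a.ext y).letter) o
    (fun _ _ h => h.symm) (fun x hx w y h => by rwa [(a.level_letter_ext_descend hx w).2] at h)
    h hx hy hpx hpy

end Neretin.AlmostAut

namespace NeretinGroup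

variable {d k : ℕ}

/-- Combines the pigeonhole argument with the transpositions at all depths along `o`. The colours
allow the conclusion to land in a smaller `Q`, which preserves more functions `F` than `K` does. -/
theorem exists_descend_eq_of_finite_orbit {H K Q : Subgroup (NeretinGroup d k)} {γ β : Type*}
    [Finite γ] (col : NeretinGroup d k → γ)
    (hcol : ∀ x ∈ K, ∀ y ∈ K, col x = col y → x⁻¹ * y ∈ Q) {a : AlmostAut d k}
    (hfin : (MulAction.orbit H (QuotientGroup.mk (mk a)⁻¹ : NeretinGroup d k ⧸ K)).Finite)
    {F : Vertex d k → β} (hF : ∀ c, mk c ∈ Q → ∀ᶠ v in cofinite, F (c.ext v) = F v)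
    {o e : Fin d} (hoe : o ≠ e) {x y : Vertex d k} (hx : x ≠ root) (hl : x.level = y.level)
    (hs : ∀ (x' y' : Vertex d k) (hx' : x' ≠ root) (hl' : x'.level = y'.level), x'.letter = x.letter →
      y'.letter = y.letter → mk (AlmostAut.swapCones hx' hl') ∈ H) :
    ∃ w, F (a.ext (descend w x)) = F (a.ext (descend w y)) := by
  have hy : y ≠ root := ne_root_of_level_eq hx hl
  have hl' : ∀ m, (descend (List.replicate m o) x).level =
      (descend (List.replicate m o) y).level := fun m => by
    rw [level_descend hx, level_descend hy, hl]
  let s : ℕ → AlmostAut d k := fun m =>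
    AlmostAut.swapCones (descend_ne_root hx (List.replicate m o)) (hl' m)
  obtain ⟨m, n, hmn, h⟩ := Subgroup.exists_lt_conj_mem_of_finite_orbit col hcol hfin
    (s := fun m => mk (s m)) (fun m => hs _ _ _ _ (letter_descend _ _) (letter_descend _ _))
  obtain ⟨c, hc⟩ := exists_mk (mk a * ((mk (s m))⁻¹ * mk (s n)) * (mk a)⁻¹)
  refine a.exists_descend_eq hoe hx hy hmn (s := s m) (t := s n)
    (AlmostAut.ext_swapCones _ _) (AlmostAut.ext_swapCones _ _) (c := c) ?_ (hF c ?_)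
  · rw [← hc, inv_mul_cancel_right, AlmostAut.inv_mk_swapCones]
  · rw [← hc]; exact h

/-- The permutation of the first letters induced by an element of `O'`. -/
def letterPerm (g : NeretinGroup d k) : Equiv.Perm (Fin k) :=
  -- Only elements of `O'` are ever compared, so the value elsewhere is irrelevant.
  Classical.epsilon fun π =>
    ∃ a, mk a = g ∧ ∀ᶠ v in cofinite, (a.ext v).letter = v.letter.map π

theorem letterPerm_spec (o : Fin d) {a : AlmostAut d k} (ha : mk a ∈ levelOneNormalizer d k) :
    ∀ᶠ v in cofinite, (a.ext v).letter = v.letter.map (letterPerm (mk a)) := by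
  obtain ⟨-, π, hπ⟩ := (mk_mem_levelOneNormalizer_iff o).1 ha
  obtain ⟨b, hb, h⟩ := Classical.epsilon_spec (p := fun π : Equiv.Perm (Fin k) =>
    ∃ b, mk b = mk a ∧ ∀ᶠ v in cofinite, (b.ext v).letter = v.letter.map π) ⟨π, a, rfl, hπ⟩
  filter_upwards [mk_eq_mk.1 hb, h] with v h1 h2
  rw [← h1, h2]
  rfl

/-- The induced permutation is the finite colouring that passes from `O'` to its subgroup of
elements preserving each first letter. -/
theorem inv_mul_mem_of_letterPerm_eq (o : Fin d) {x y : NeretinGroup d k}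
    (hx : x ∈ levelOneNormalizer d k) (hy : y ∈ levelOneNormalizer d k)
    (h : letterPerm x = letterPerm y) : x⁻¹ * y ∈ ballSubgroup d k ⊓ letterStabilizer d k := by
  refine ⟨mul_mem ((ballSubgroup d k).inv_mem (levelOneNormalizer_le_ballSubgroup hx))
    (levelOneNormalizer_le_ballSubgroup hy), ?_⟩
  obtain ⟨a, rfl⟩ := exists_mk x
  obtain ⟨b, rfl⟩ := exists_mk y
  refine ⟨a.inv.comp b, rfl, ?_⟩
  filter_upwards [a.inv.ext_comp b, (a.inv.tendsto_ext.comp b.tendsto_ext).eventually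
    (letterPerm_spec o hx), letterPerm_spec o hy,
    b.tendsto_ext.eventually a.ext_ext_inv_eventually] with v h1 h2 h3 h4
  simp only [Function.comp_apply] at h2
  rw [h4, h3, h] at h2
  rw [h1]
  exact (Option.map_injective (letterPerm (mk b)).injective h2).symm

/-- Here `H = K = Q = O`, one colour suffices and `F` is the level. All transpositions are
available, so `a` has one global shift, which counting shows to be zero. -/
theorem mem_ballSubgroup_of_finite_orbit (hd : 2 ≤ d) (hk : 2 ≤ k) {a : AlmostAut d k}
    (hfin : (MulAction.orbit (ballSubgroup d k)
      (QuotientGroup.mk (mk a)⁻¹ : NeretinGroup d k ⧸ ballSubgroup d k)).Finite) :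
    mk a ∈ ballSubgroup d k := by
  have hoe : (⟨0, by omega⟩ : Fin d) ≠ ⟨1, by omega⟩ := by simp
  obtain ⟨c, hc⟩ := a.exists_shift ⟨0, by omega⟩ (p := fun _ => True)
    fun x hx y hy _ _ hl => by
      obtain ⟨w, hw⟩ := exists_descend_eq_of_finite_orbit (F := level) (fun _ => ())
        (fun x hx y hy _ => mul_mem (inv_mem hx) hy) hfin
        (fun c => AlmostAut.mk_mem_ballSubgroup_iff.1) hoe (AlmostAut.ne_root_of_notMem hx) hl
        (fun _ _ hx' hl' _ _ => AlmostAut.mk_swapCones_mem_ballSubgroup hx' hl')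
      rw [(a.level_letter_ext_descend hx w).1, (a.level_letter_ext_descend hy w).1] at hw
      omega
  have h0 := a.shift_eq_zero hd (S := Finset.univ) (T := Finset.univ)
    ⟨⟨0, by omega⟩, Finset.mem_univ _⟩ rfl (fun _ _ _ _ _ _ => by simp)
    (fun v hv _ _ _ => hc v hv trivial)
  refine AlmostAut.mk_mem_ballSubgroup_iff.2 ?_
  filter_upwards [a.A.compl_mem_cofinite] with v hv
  have := hc v hv trivial
  omega

/-- Only transpositions within one first letter are available, and `F` records level and letter
together. Thus `a` permutes the letters and has a shift on each of the `k` cones; counting the cone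
of `i` against that of `π i` makes each shift zero. -/
theorem mem_levelOneNormalizer_of_finite_orbit (hd : 2 ≤ d) {a : AlmostAut d k}
    (hfin : (MulAction.orbit (levelOneNormalizer d k)
      (QuotientGroup.mk (mk a)⁻¹ : NeretinGroup d k ⧸ levelOneNormalizer d k)).Finite) :
    mk a ∈ levelOneNormalizer d k := by
  have hoe : (⟨0, by omega⟩ : Fin d) ≠ ⟨1, by omega⟩ := by simp
  have key : ∀ x ∉ a.A.verts, ∀ y ∉ a.A.verts, x.letter = y.letter → x.level = y.level →
      (a.ext x).level = (a.ext y).level ∧ (a.ext x).letter = (a.ext y).letter := by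
    intro x hx y hy hxy hl
    obtain ⟨w, hw⟩ := exists_descend_eq_of_finite_orbit (F := fun v => (v.level, v.letter))
      letterPerm (fun x hx y hy => inv_mul_mem_of_letterPerm_eq ⟨0, by omega⟩ hx hy) hfin
      (fun c hc => by
        filter_upwards [AlmostAut.mk_mem_ballSubgroup_iff.1 hc.1,
          mk_mem_letterStabilizer_iff.1 hc.2] with v h1 h2
        rw [h1, h2])
      hoe (AlmostAut.ne_root_of_notMem hx) hl
      (fun x' y' hx' hl' h1 h2 => levelOneProduct_le_levelOneNormalizer
        (mk_swapCones_mem_levelOneProduct hx' hl' (h1.trans (hxy.trans h2.symm))))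
    rw [(a.level_letter_ext_descend hx w).1, (a.level_letter_ext_descend hy w).1,
      (a.level_letter_ext_descend hx w).2, (a.level_letter_ext_descend hy w).2,
      Prod.mk.injEq] at hw
    exact ⟨by omega, hw.2⟩
  obtain ⟨π, hπ⟩ := a.exists_perm_letter ⟨0, by omega⟩ fun x hx y hy hxy =>
    a.letter_eq_of_level_eq ⟨0, by omega⟩ (p := fun l => l = x.letter)
      (fun x hx y hy h1 h2 hl => (key x hx y hy (h1.trans h2.symm) hl).2) hx hy rfl hxy.symm
  refine (mk_mem_levelOneNormalizer_iff ⟨0, by omega⟩).2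
    ⟨AlmostAut.mk_mem_ballSubgroup_iff.2 ?_, π, a.A.compl_mem_cofinite.mono hπ⟩
  filter_upwards [a.A.compl_mem_cofinite] with v hv
  obtain ⟨i, hi⟩ := letter_eq_some (AlmostAut.ne_root_of_notMem hv)
  obtain ⟨c, hc⟩ := a.exists_shift ⟨0, by omega⟩ (p := fun l => l = some i)
    fun x hx y hy h1 h2 hl => (key x hx y hy (h1.trans h2.symm) hl).1
  have h0 := a.shift_eq_zero hd (S := {i}) (T := {π i}) (Finset.singleton_nonempty i)
    (by simp) (c := c) (fun v hv i' j h1 h2 => by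
      rw [hπ v hv, h1, Option.map_some, Option.some.injEq] at h2
      simp [← h2])
    (fun v hv i' hi' h1 => hc v hv (by rw [h1, Finset.mem_singleton.1 hi']))
  have := hc v hv hi
  omega

/-- Now `O` acts and may transpose cones with different first letters, so a finite orbit would give
all images under `a` the same first letter, although two letters occur outside `B`. -/
theorem infinite_orbit_levelOneNormalizer (hd : 2 ≤ d) (hk : 2 ≤ k) (a : AlmostAut d k) :
    (MulAction.orbit (ballSubgroup d k)
      (QuotientGroup.mk (mk a)⁻¹ : NeretinGroup d k ⧸ levelOneNormalizer d k)).Infinite := by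
  intro hfin
  have hoe : (⟨0, by omega⟩ : Fin d) ≠ ⟨1, by omega⟩ := by simp
  have key : ∀ x ∉ a.A.verts, ∀ y ∉ a.A.verts, x.level = y.level →
      (a.ext x).letter = (a.ext y).letter := by
    intro x hx y hy hl
    obtain ⟨w, hw⟩ := exists_descend_eq_of_finite_orbit (F := letter)
      letterPerm (fun x hx y hy => inv_mul_mem_of_letterPerm_eq ⟨0, by omega⟩ hx hy) hfin
      (fun c hc => mk_mem_letterStabilizer_iff.1 hc.2) hoe (AlmostAut.ne_root_of_notMem hx) hl
      (fun _ _ hx' hl' _ _ => AlmostAut.mk_swapCones_mem_ballSubgroup hx' hl')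
    rwa [(a.level_letter_ext_descend hx w).2, (a.level_letter_ext_descend hy w).2] at hw
  obtain ⟨u, hu, hul⟩ := exists_letter_notMem (⟨0, by omega⟩ : Fin d) a.B.finite
    (⟨0, by omega⟩ : Fin k)
  obtain ⟨v, hv, hvl⟩ := exists_letter_notMem (⟨0, by omega⟩ : Fin d) a.B.finite
    (⟨1, by omega⟩ : Fin k)
  have h := a.letter_eq_of_level_eq ⟨0, by omega⟩ (p := fun _ => True)
    (fun x hx y hy _ _ hl => key x hx y hy hl) (a.ext_inv_notMem hu) (a.ext_inv_notMem hv)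
    trivial trivial
  rw [a.ext_ext_inv hu, a.ext_ext_inv hv, hul, hvl] at h
  simp at h

end NeretinGroup

/-! ### Quasi-regular representations -/

namespace UnitaryRep

open scoped InnerProductSpace

variable {G : Type*} [Group G]

/-- A square-summable function that is invariant under a group vanishes on its infinite orbits. -/
theorem ellTwo_eq_zero_of_infinite_orbit {X : Type*} {H : Subgroup G} [MulAction G X]
    (f : EllTwo X) {x : X} (hf : ∀ h ∈ H, ∀ x, f (h • x) = f x)
    (hx : (MulAction.orbit H x).Infinite) : f x = 0 := by
  by_contra hne
  have hs : Summable fun x => ‖f x‖ ^ (2 : ENNReal).toReal :=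
    (memℓp_gen_iff (by norm_num)).1 (lp.memℓp f)
  have hpos : 0 < ‖f x‖ ^ (2 : ENNReal).toReal := Real.rpow_pos_of_pos (norm_pos_iff.2 hne) _
  -- Terms of a convergent series are eventually below the positive value at `x`, but on the orbit
  -- they all equal it.
  have hfin := eventually_cofinite.1 (hs.tendsto_cofinite_zero.eventually (gt_mem_nhds hpos))
  refine hx (hfin.subset ?_)
  rintro _ ⟨⟨h, hh⟩, rfl⟩
  change ¬ ‖f (h • x)‖ ^ _ < _
  rw [hf h hh]
  exact lt_irrefl _

open Classical in
theorem quasiRegular_single (H : Subgroup G) (g : G) (x : G ⧸ H) (c : ℂ) :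
    quasiRegular H g (lp.single 2 x c) = lp.single 2 (g • x) c := by
  ext y
  rw [quasiRegular_apply, lp.single_apply, lp.single_apply]
  by_cases h : y = g • x
  · subst h
    simp
  · rw [Pi.single_eq_of_ne h, Pi.single_eq_of_ne fun h' => h (by rw [← h', smul_inv_smul])]

theorem apply_smul_eq_of_invariant {H K : Subgroup G} {f : EllTwo (G ⧸ K)}
    (hf : ∀ h ∈ H, quasiRegular K h f = f) : ∀ h ∈ H, ∀ x, f (h • x) = f x := by
  intro h hh x
  have := congrArg (fun f : EllTwo (G ⧸ K) => f x) (hf h⁻¹ (inv_mem hh))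
  rwa [quasiRegular_apply, inv_inv] at this

open Classical in
theorem quasiRegular_single_one (H : Subgroup G) (c : ℂ) {h : G} (hh : h ∈ H) :
    quasiRegular H h (lp.single 2 (QuotientGroup.mk 1 : G ⧸ H) c) =
      lp.single 2 (QuotientGroup.mk 1) c := by
  rw [quasiRegular_single]
  congr 1
  exact QuotientGroup.eq.2 (by simpa using hh)

/-- The span of the point masses is dense in `ℓ²(X)`. -/
theorem mem_of_single_mem {X : Type*} [DecidableEq X] {W : Submodule ℂ (EllTwo X)}
    (hW : IsClosed (W : Set (EllTwo X))) (h : ∀ x c, lp.single 2 x c ∈ W) (f : EllTwo X) :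
    f ∈ W :=
  hW.mem_of_tendsto (lp.hasSum_single (by norm_num) f)
    (Eventually.of_forall fun _ => W.sum_mem fun _ _ => h _ _)

/-- Mackey's criterion, sufficiency. -/
theorem isIrreducible_quasiRegular (H : Subgroup G)
    (h : ∀ x : G ⧸ H, (MulAction.orbit H x).Finite → x = QuotientGroup.mk 1) :
    IsIrreducible (quasiRegular H) := by
  classical
  let e : G ⧸ H := QuotientGroup.mk 1
  let δ : EllTwo (G ⧸ H) := lp.single 2 e 1
  have hδ : δ ≠ 0 := fun h0 => by
    have := congrArg (fun f : EllTwo (G ⧸ H) => f e) h0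
    simp [δ, lp.single_apply] at this
  have hδe : δ e = 1 := by simp [δ, lp.single_apply]
  refine ⟨⟨δ, 0, hδ⟩, fun W hW hinv => ?_⟩
  -- The point mass at the base point is cyclic: its translates are all the point masses.
  have htop : ∀ V : Submodule ℂ (EllTwo (G ⧸ H)), IsClosed (V : Set (EllTwo (G ⧸ H))) →
      (∀ g, ∀ v ∈ V, quasiRegular H g v ∈ V) → δ ∈ V → ∀ f, f ∈ V := by
    intro V hV hinv hmem
    refine mem_of_single_mem hV fun x c => ?_
    obtain ⟨g, rfl⟩ := QuotientGroup.mk_surjective x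
    have h1 := V.smul_mem c (hinv g δ hmem)
    have h2 : g • e = QuotientGroup.mk g := by
      change (QuotientGroup.mk (g * 1) : G ⧸ H) = _
      rw [mul_one]
    rw [quasiRegular_single, h2, ← lp.single_smul, smul_eq_mul, mul_one] at h1
    exact h1
  have hinv' : ∀ g, ∀ v ∈ Wᗮ, quasiRegular H g v ∈ Wᗮ := by
    intro g v hv
    refine (Submodule.mem_orthogonal _ _).2 fun u hu => ?_
    have h1 : quasiRegular H g (quasiRegular H g⁻¹ u) = u := by
      ext x
      rw [quasiRegular_apply, quasiRegular_apply, inv_inv, smul_inv_smul]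
    rw [← h1, (quasiRegular H g).inner_map_map]
    exact (Submodule.mem_orthogonal _ _).1 hv _ (hinv _ _ hu)
  have : CompleteSpace W := hW.completeSpace_coe
  obtain ⟨p, hp, q, hq, hpq⟩ : ∃ p ∈ W, ∃ q ∈ Wᗮ, δ = p + q := W.exists_add_mem_mem_orthogonal δ
  -- `H` fixes `δ` and preserves `W` and its orthogonal complement, so it fixes both components of
  -- `δ`.
  have hpinv : ∀ g ∈ H, quasiRegular H g p = p := by
    intro g hg
    have h2 : quasiRegular H g p + quasiRegular H g q = p + q := by
      rw [← map_add, ← hpq]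
      exact quasiRegular_single_one H 1 hg
    have h3 : quasiRegular H g p - p = q - quasiRegular H g q := by
      rw [sub_eq_sub_iff_add_eq_add, h2, add_comm]
    have h4 : quasiRegular H g p - p ∈ W ⊓ Wᗮ :=
      ⟨W.sub_mem (hinv g p hp) hp, h3 ▸ Wᗮ.sub_mem hq (hinv' g q hq)⟩
    rw [Submodule.inf_orthogonal_eq_bot, Submodule.mem_bot] at h4
    exact sub_eq_zero.1 h4
  -- Off the base point all orbits are infinite, so `p` is supported there. Thus `δ` lies in `W` or
  -- in its orthogonal complement, according to whether `p e` vanishes.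
  have hp' : p = p e • δ := by
    ext x
    by_cases hx : x = e
    · subst hx
      rw [lp.coeFn_smul, Pi.smul_apply, hδe, smul_eq_mul, mul_one]
    · rw [ellTwo_eq_zero_of_infinite_orbit p (apply_smul_eq_of_invariant hpinv)
        (fun hfin => hx (h x hfin)), lp.coeFn_smul, Pi.smul_apply]
      simp [δ, lp.single_apply, Pi.single_eq_of_ne hx]
  by_cases hpe : p e = 0
  · left
    rw [hpe, zero_smul] at hp'
    rw [hp', zero_add] at hpq
    have h1 := htop Wᗮ W.isClosed_orthogonal hinv' (hpq ▸ hq)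
    refine (Submodule.eq_bot_iff _).2 fun f hf => ?_
    have h4 : f ∈ W ⊓ Wᗮ := ⟨hf, h1 f⟩
    rwa [Submodule.inf_orthogonal_eq_bot, Submodule.mem_bot] at h4
  · right
    have h1 : δ = (p e)⁻¹ • p := by
      rw [eq_inv_smul_iff₀ hpe]
      exact hp'.symm
    exact (Submodule.eq_top_iff').2 (htop W hW hinv (h1 ▸ W.smul_mem _ hp))

theorem not_areEquivalent_quasiRegular (H K : Subgroup G)
    (h : ∀ x : G ⧸ K, (MulAction.orbit H x).Infinite) :
    ¬ AreEquivalent (quasiRegular H) (quasiRegular K) := by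
  classical
  rintro ⟨U, hU⟩
  let δ : EllTwo (G ⧸ H) := lp.single 2 (QuotientGroup.mk 1) 1
  have hinv : ∀ g ∈ H, quasiRegular K g (U δ) = U δ := fun g hg => by
    rw [← hU, quasiRegular_single_one H 1 hg]
  have h0 : U δ = 0 := by
    ext x
    exact ellTwo_eq_zero_of_infinite_orbit _ (apply_smul_eq_of_invariant hinv) (h x)
  have h1 := congrArg (fun f : EllTwo (G ⧸ H) => f (QuotientGroup.mk 1))
    ((map_eq_zero_iff U U.injective).1 h0)
  simp [δ, lp.single_apply] at h1

/-- Vectors with continuous orbit maps form a closed subspace, as the operators are isometric. It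
contains the point masses because `G ⧸ H` is discrete. -/
theorem isStronglyContinuous_quasiRegular [TopologicalSpace G] [IsTopologicalGroup G]
    (H : Subgroup G) (hH : IsOpen (H : Set G)) : IsStronglyContinuous (quasiRegular H) := by
  classical
  have := QuotientGroup.discreteTopology hH
  let W : Submodule ℂ (EllTwo (G ⧸ H)) :=
    { carrier := {f | Continuous fun g => quasiRegular H g f}
      add_mem' := fun {u v} hu hv => by
        simp only [Set.mem_ofPred_eq, map_add]
        exact Continuous.add hu hv
      zero_mem' := by
        simp only [Set.mem_ofPred_eq, map_zero]
        exact continuous_const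
      smul_mem' := fun c u hu => by
        simp only [Set.mem_ofPred_eq, map_smul]
        exact Continuous.const_smul hu c }
  have hW : IsClosed (W : Set (EllTwo (G ⧸ H))) := by
    refine isClosed_of_closure_subset fun f hf => ?_
    refine continuous_of_uniform_approx_of_continuous fun u hu => ?_
    obtain ⟨ε, hε, hεu⟩ := Metric.mem_uniformity_dist.1 hu
    obtain ⟨f', hf', hd⟩ := Metric.mem_closure_iff.1 hf ε hε
    exact ⟨fun g => quasiRegular H g f', hf', fun g => hεu (by
      rwa [(quasiRegular H g).dist_map])⟩
  refine fun f => mem_of_single_mem hW (fun x c => ?_) f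
  change Continuous fun g => quasiRegular H g (lp.single 2 x c)
  simp only [quasiRegular_single]
  obtain ⟨y, rfl⟩ := QuotientGroup.mk_surjective x
  have h1 : Continuous fun g : G => g • (QuotientGroup.mk y : G ⧸ H) :=
    QuotientGroup.continuous_mk.comp (continuous_mul_const y)
  exact (continuous_of_discreteTopology (f := fun z : G ⧸ H =>
    (lp.single 2 z c : EllTwo (G ⧸ H)))).comp h1

end UnitaryRep

/-! ### Amenability of increasing unions of compact groups -/

open MeasureTheory in
/-- The mean of a compact group given by its normalized Haar measure. -/
theorem exists_invariant_mean_of_compactSpace (K : Type*) [Group K] [TopologicalSpace K]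
    [IsTopologicalGroup K] [CompactSpace K] : ∃ m : C(K, ℝ) →ₗ[ℝ] ℝ,
    (∀ f, 0 ≤ f → 0 ≤ m f) ∧ m 1 = 1 ∧
      ∀ (g : K) (f : C(K, ℝ)), m (f.comp ⟨fun x => g * x, continuous_const_mul g⟩) = m f := by
  borelize K
  let μ : Measure K := Measure.haarMeasure ⊤
  have hμ : IsProbabilityMeasure μ :=
    ⟨Measure.haarMeasure_self (K₀ := (⊤ : TopologicalSpace.PositiveCompacts K))⟩
  have hint : ∀ f : C(K, ℝ), Integrable f μ := fun f =>
    f.continuous.integrable_of_hasCompactSupport (HasCompactSupport.of_compactSpace f)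
  refine ⟨{ toFun := fun f => ∫ x, f x ∂μ
            map_add' := fun f g => integral_add (hint f) (hint g)
            map_smul' := fun c f => integral_const_mul c f }, fun f hf => integral_nonneg hf,
    by simp, fun g f => integral_mul_left_eq_self f g⟩

/-- A topological group that is the union of an increasing sequence of compact subgroups is
amenable. -/
theorem isAmenable_of_iUnion_compact {G : Type*} [Group G] [TopologicalSpace G]
    [IsTopologicalGroup G] {K : ℕ → Subgroup G} (hK : ∀ n, IsCompact (K n : Set G))
    (hmono : Monotone K) (hunion : ∀ g, ∃ n, g ∈ K n) : IsAmenable G := by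
  have : ∀ n, CompactSpace (K n) := fun n => isCompact_iff_compactSpace.1 (hK n)
  choose m hpos hone hinv using fun n => exists_invariant_mean_of_compactSpace (K n)
  let r : ∀ n, BoundedContinuousFunction G ℝ → C(K n, ℝ) := fun n f =>
    f.toContinuousMap.comp ⟨Subtype.val, continuous_subtype_val⟩
  let M : ℕ → BoundedContinuousFunction G ℝ → ℝ := fun n f => m n (r n f)
  -- The bounded sequence of Haar means of the restrictions of `f` converges along an ultrafilter,
  -- linearly in `f`.
  let U : Ultrafilter ℕ := hyperfilter ℕ
  have hmonoM : ∀ n (f g : C(K n, ℝ)), f ≤ g → m n f ≤ m n g := fun n f g h => by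
    have := hpos n (g - f) (sub_nonneg.2 h)
    rw [map_sub] at this
    linarith
  have hbound : ∀ f n, M n f ∈ Set.Icc (-‖f‖) ‖f‖ := by
    intro f n
    have h1 : ∀ c : ℝ, m n (c • 1) = c := fun c => by rw [map_smul, hone, smul_eq_mul, mul_one]
    constructor
    · rw [← h1 (-‖f‖)]
      refine hmonoM _ _ _ fun x => ?_
      simpa [r] using (abs_le.1 (f.norm_coe_le_norm x)).1
    · rw [← h1 ‖f‖]
      refine hmonoM _ _ _ fun x => ?_
      simpa [r] using (abs_le.1 (f.norm_coe_le_norm x)).2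
  have hlim : ∀ f, ∃ l, Tendsto (fun n => M n f) U (nhds l) := by
    intro f
    obtain ⟨l, -, hl⟩ := (isCompact_Icc (a := -‖f‖) (b := ‖f‖)).ultrafilter_le_nhds
      (U.map fun n => M n f) (le_principal_iff.2 (Filter.mem_map.2 (Eventually.of_forall (hbound f))))
    exact ⟨l, hl⟩
  choose l hl using hlim
  refine ⟨{ toFun := l
            map_add' := fun f g => tendsto_nhds_unique (hl (f + g)) ?_
            map_smul' := fun c f => tendsto_nhds_unique (hl (c • f)) ?_ },
    fun f hf => ?_, ?_, fun g f => ?_⟩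
  · have h1 : (fun n => M n (f + g)) = fun n => M n f + M n g :=
      funext fun n => map_add (m n) (r n f) (r n g)
    rw [h1]
    exact (hl f).add (hl g)
  · have h1 : (fun n => M n (c • f)) = fun n => c • M n f :=
      funext fun n => map_smul (m n) c (r n f)
    rw [h1]
    exact (hl f).const_smul c
  · exact ge_of_tendsto' (hl f) fun n => hpos n _ fun x => hf x
  · refine tendsto_nhds_unique (hl _) ?_
    have h1 : (fun n => M n (BoundedContinuousFunction.const G 1)) = fun _ => 1 :=
      funext fun n => hone n
    rw [h1]
    exact tendsto_const_nhds
  -- `g` lies in `K n` for all large `n`, so the `n`-th mean is eventually invariant under `g`; the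
  -- ultrafilter ignores the finitely many other indices.
  · refine tendsto_nhds_unique (hl _) ((hl f).congr' ?_)
    obtain ⟨N, hN⟩ := hunion g
    refine Filter.Eventually.filter_mono (Nat.hyperfilter_le_atTop) ?_
    filter_upwards [eventually_ge_atTop N] with n hn
    exact (hinv n ⟨g, hmono hn hN⟩ (r n f)).symm

/-! ### Compactness of the automorphism group of the tree; gluing outside a ball -/

namespace Neretin

variable {d k : ℕ}

theorem level_treeAut (σ : treeAut d k) (v : Vertex d k) : (σ.1 v).level = v.level := by
  by_cases hv : v = root
  · rw [hv, treeAut_root]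
  · rw [← AlmostAut.ext_ofAut]
    exact NeretinGroup.level_ext_of_ball (n := 0) rfl rfl v fun h => hv (mem_ball_zero.1 h)

theorem Vertex.finite_level_eq (n : ℕ) : {v : Vertex d k | v.level = n}.Finite :=
  (finite_level_le n).subset fun _ h => le_of_eq h

/-- Automorphisms form a closed subset of a product of finite level sets. Injectivity is a closed
condition, and surjectivity follows from it on each finite level. -/
instance : CompactSpace (treeAut d k) := by
  have hind : Topology.IsInducing fun (σ : treeAut d k) (v : Vertex d k) => σ.1 v := ⟨rfl⟩
  refine ⟨hind.isCompact_iff.2 ?_⟩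
  have himage : (fun (σ : treeAut d k) (v : Vertex d k) => σ.1 v) '' Set.univ =
      (Set.univ.pi fun v => {w : Vertex d k | w.level = v.level}) ∩
      ⋂ (u : Vertex d k) (v : Vertex d k), {f : Vertex d k → Vertex d k |
        (IsParent (f u) (f v) ↔ IsParent u v) ∧ (f u = f v → u = v)} := by
    ext f
    simp only [Set.image_univ, Set.mem_range, Set.mem_inter_iff, Set.mem_pi, Set.mem_univ,
      forall_const, Set.mem_iInter, Set.mem_ofPred_eq]
    constructor
    · rintro ⟨σ, rfl⟩
      exact ⟨level_treeAut σ, fun u v => ⟨treeAut_isParent σ u v, fun h => σ.1.injective h⟩⟩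
    · rintro ⟨h1, h2⟩
      have hinj : Function.Injective f := fun u v => (h2 u v).2
      have hsurj : Function.Surjective f := by
        intro w
        have : Finite {v : Vertex d k // v.level = w.level} := (finite_level_eq w.level).to_subtype
        let F : {v : Vertex d k // v.level = w.level} → {v : Vertex d k // v.level = w.level} :=
          fun v => ⟨f v.1, (h1 v.1).trans v.2⟩
        have hF : Function.Injective F := fun u v h =>
          Subtype.ext (hinj (congrArg Subtype.val h))
        obtain ⟨v, hv⟩ := Finite.injective_iff_surjective.1 hF ⟨w, rfl⟩
        exact ⟨v.1, congrArg Subtype.val hv⟩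
      exact ⟨⟨Equiv.ofBijective f ⟨hinj, hsurj⟩, fun u v => (h2 u v).1⟩, rfl⟩
  rw [himage]
  refine (isCompact_univ_pi fun v : Vertex d k => (finite_level_eq v.level).isCompact).inter_right
    (isClosed_iInter fun u => isClosed_iInter fun v => ?_)
  have hc : Continuous fun f : Vertex d k → Vertex d k => (f u, f v) :=
    (continuous_apply u).prodMk (continuous_apply v)
  exact (isClosed_discrete {p : Vertex d k × Vertex d k |
    (IsParent p.1 p.2 ↔ IsParent u v) ∧ (p.1 = p.2 → u = v)}).preimage hc

namespace AlmostAut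

/-- The composite is needed exactly outside the ball, not just up to finitely many vertices, in
order to read off its action on level `n + 1`. -/
theorem exists_comp_ball {a b : AlmostAut d k} {n : ℕ} (haA : a.A = Subtree.ball d k n)
    (haB : a.B = Subtree.ball d k n) (hbA : b.A = Subtree.ball d k n)
    (hbB : b.B = Subtree.ball d k n) :
    ∃ c : AlmostAut d k, c.A = Subtree.ball d k n ∧ c.B = Subtree.ball d k n ∧
      NeretinGroup.mk c = NeretinGroup.mk a * NeretinGroup.mk b ∧
      ∀ v ∉ (Subtree.ball d k n).verts, c.ext v = a.ext (b.ext v) := by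
  have ha : ∀ v ∉ (Subtree.ball d k n).verts, a.ext v ∉ (Subtree.ball d k n).verts := fun v hv =>
    haB ▸ a.ext_notMem (haA ▸ hv)
  have hb : ∀ v ∉ (Subtree.ball d k n).verts, b.ext v ∉ (Subtree.ball d k n).verts := fun v hv =>
    hbB ▸ b.ext_notMem (hbA ▸ hv)
  have ha' : ∀ v ∉ (Subtree.ball d k n).verts, a.inv.ext v ∉ (Subtree.ball d k n).verts :=
    fun v hv => haA ▸ a.ext_inv_notMem (haB ▸ hv)
  have hb' : ∀ v ∉ (Subtree.ball d k n).verts, b.inv.ext v ∉ (Subtree.ball d k n).verts :=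
    fun v hv => hbA ▸ b.ext_inv_notMem (hbB ▸ hv)
  let c : AlmostAut d k := ofMaps (Subtree.ball d k n) (Subtree.ball d k n)
    (fun v => a.ext (b.ext v)) (fun v => b.inv.ext (a.inv.ext v))
    (fun v hv => ha _ (hb v hv)) (fun v hv => hb' _ (ha' v hv))
    (fun v hv => by rw [a.ext_inv_ext (haA ▸ hb v hv), b.ext_inv_ext (hbA ▸ hv)])
    (fun v hv => by rw [b.ext_ext_inv (hbB ▸ ha' v hv), a.ext_ext_inv (haB ▸ hv)])
    (fun u hu v hv => by
      rw [a.isParent_ext (haA ▸ hb u hu) (haA ▸ hb v hv), b.isParent_ext (hbA ▸ hu) (hbA ▸ hv)])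
  have hc : ∀ v ∉ (Subtree.ball d k n).verts, c.ext v = a.ext (b.ext v) := fun v hv =>
    c.ext_of_notMem hv
  refine ⟨c, rfl, rfl, ?_, hc⟩
  rw [NeretinGroup.mk_mul_mk, NeretinGroup.mk_eq_mk]
  filter_upwards [a.ext_comp b, (Subtree.ball d k n).compl_mem_cofinite] with v h1 h2
  rw [h1, hc v h2]

/-- An almost automorphism defined outside a ball that fixes the vertices adjacent to the ball
extends to an automorphism of the tree. -/
theorem exists_ofTreeAut_eq {a : AlmostAut d k} {n : ℕ} (hA : a.A = Subtree.ball d k n)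
    (hB : a.B = Subtree.ball d k n) (h : ∀ v : Vertex d k, v.level = n + 1 → a.ext v = v) :
    ∃ τ, NeretinGroup.ofTreeAut d k τ = NeretinGroup.mk a := by
  -- Glue with the identity on the ball; fixing level `n + 1` makes the edges leaving the ball
  -- match.
  let F : AlmostAut d k → Vertex d k → Vertex d k := fun a v =>
    if v.level ≤ n then v else a.ext v
  have hnot : ∀ v : Vertex d k, ¬ v.level ≤ n → v ∉ (Subtree.ball d k n).verts := fun v hv => hv
  have hinv : ∀ a : AlmostAut d k, a.A = Subtree.ball d k n → a.B = Subtree.ball d k n →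
      ∀ v, F a.inv (F a v) = v := by
    intro a hA hB v
    by_cases hv : v.level ≤ n
    · simp only [F, if_pos hv]
    · have h1 : v ∉ a.A.verts := hA ▸ hnot v hv
      simp only [F, if_neg hv]
      rw [if_neg (by rwa [NeretinGroup.level_ext_of_ball hA hB v h1]), a.ext_inv_ext h1]
  have hpar : ∀ a : AlmostAut d k, a.A = Subtree.ball d k n →
      (∀ v : Vertex d k, v.level = n + 1 → a.ext v = v) →
      ∀ u v, IsParent u v → IsParent (F a u) (F a v) := by
    intro a hA h u v huv
    have hl := huv.level
    by_cases hu : u.level ≤ n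
    · simp only [F, if_pos hu]
      by_cases hv : v.level ≤ n
      · rwa [if_pos hv]
      · rwa [if_neg hv, h v (by omega)]
    · simp only [F, if_neg hu, if_neg (by omega : ¬ v.level ≤ n)]
      exact (a.isParent_ext (hA ▸ hnot u hu) (hA ▸ hnot v (by omega))).2 huv
  have h' : ∀ v : Vertex d k, v.level = n + 1 → a.inv.ext v = v := fun v hv => by
    conv_lhs => rw [← h v hv]
    exact a.ext_inv_ext (hA ▸ hnot v (by omega))
  have hinv1 := hinv a hA hB
  have hinv2 : ∀ v, F a (F a.inv v) = v := hinv a.inv hB hA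
  refine ⟨⟨⟨F a, F a.inv, hinv1, hinv2⟩, fun u v => ⟨fun huv => ?_, hpar a hA h u v⟩⟩,
    NeretinGroup.mk_eq_mk.2 ?_⟩
  · have := hpar a.inv hB h' _ _ huv
    simp only [Equiv.coe_fn_mk] at this
    rwa [hinv1, hinv1] at this
  · filter_upwards [(Subtree.ball d k n).compl_mem_cofinite] with v hv
    rw [ext_ofAut]
    exact if_neg hv

end AlmostAut

end Neretin

/-! ### The group `O` as a union of compact subgroups; openness -/

namespace NeretinGroup

variable {d k : ℕ}

/-- The subgroup of the elements represented by an almost automorphism defined outside the ball of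
radius `n`. -/
def ballSubgroupLevel (d k n : ℕ) : Subgroup (NeretinGroup d k) where
  carrier := {g | ∃ a : AlmostAut d k,
    a.A = Subtree.ball d k n ∧ a.B = Subtree.ball d k n ∧ mk a = g}
  one_mem' := by
    obtain ⟨b, h1, h2, h3⟩ := (AlmostAut.ofAut (1 : treeAut d k)).exists_ball (n := n)
      (fun v hv => le_trans hv n.zero_le) (fun v hv => le_trans hv n.zero_le)
      (fun v _ => by rw [AlmostAut.ext_ofAut]; rfl)
      (fun v _ => by
        change ((AlmostAut.ofAut (1 : treeAut d k)⁻¹).ext v).level = _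
        rw [AlmostAut.ext_ofAut, inv_one]; rfl)
    exact ⟨b, h1, h2, h3⟩
  inv_mem' := by
    rintro _ ⟨a, hA, hB, rfl⟩
    exact ⟨a.inv, hB, hA, rfl⟩
  mul_mem' := by
    rintro _ _ ⟨a, haA, haB, rfl⟩ ⟨b, hbA, hbB, rfl⟩
    obtain ⟨c, h1, h2, h3, -⟩ := AlmostAut.exists_comp_ball haA haB hbA hbB
    exact ⟨c, h1, h2, h3⟩

theorem ballSubgroupLevel_mono : Monotone (ballSubgroupLevel d k) := by
  rintro m n hmn _ ⟨a, hA, hB, rfl⟩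
  refine a.exists_ball (fun v hv => ?_) (fun v hv => ?_) (fun v hv => ?_) (fun v hv => ?_)
  · rw [hA] at hv; exact le_trans hv hmn
  · rw [hB] at hv; exact le_trans hv hmn
  · exact level_ext_of_ball hA hB v (by rw [hA, mem_ball]; omega)
  · exact level_ext_of_ball (a := a.inv) hB hA v
      (by change v ∉ a.B.verts; rw [hB, mem_ball]; omega)

theorem exists_mem_ballSubgroupLevel {g : NeretinGroup d k} (hg : g ∈ ballSubgroup d k) :
    ∃ n, g ∈ ballSubgroupLevel d k n := by
  obtain ⟨a, n, h⟩ := hg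
  exact ⟨n, a, h⟩

theorem ofTreeAut_mem_ballSubgroupLevel (τ : treeAut d k) (n : ℕ) :
    ofTreeAut d k τ ∈ ballSubgroupLevel d k n :=
  ballSubgroupLevel_mono n.zero_le ⟨AlmostAut.ofAut τ, rfl, rfl, rfl⟩

/-- Two elements inducing the same map on the finite level `n + 1` differ by a tree automorphism, so
the subgroup is a finite union of translates of the compact image of `treeAut d k`. -/
theorem isCompact_ballSubgroupLevel (n : ℕ) :
    IsCompact (ballSubgroupLevel d k n : Set (NeretinGroup d k)) := by
  choose a hA hB ha using fun g : ballSubgroupLevel d k n => g.2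
  have : Finite {v : Vertex d k // v.level = n + 1} := (finite_level_eq (n + 1)).to_subtype
  have hnot : ∀ v : Vertex d k, v.level = n + 1 → v ∉ (Subtree.ball d k n).verts := fun v hv => by
    rw [mem_ball]; omega
  let code : ballSubgroupLevel d k n →
      {v : Vertex d k // v.level = n + 1} → {v : Vertex d k // v.level = n + 1} :=
    fun g v => ⟨(a g).ext v.1, (level_ext_of_ball (hA g) (hB g) v.1
      (by rw [hA g]; exact hnot _ v.2)).trans v.2⟩
  choose r hr using fun c : Set.range code => c.2
  have hunion : (ballSubgroupLevel d k n : Set (NeretinGroup d k)) =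
      ⋃ c : Set.range code, (fun x => (r c : NeretinGroup d k) * x) ''
        Set.range (ofTreeAut d k) := by
    ext g
    simp only [SetLike.mem_coe, Set.mem_iUnion, Set.mem_image, Set.mem_range,
      exists_exists_eq_and]
    constructor
    · intro hg
      let g' : ballSubgroupLevel d k n := ⟨g, hg⟩
      let h : ballSubgroupLevel d k n := r ⟨code g', g', rfl⟩
      have hcode : code h = code g' := hr ⟨code g', g', rfl⟩
      refine ⟨⟨code g', g', rfl⟩, ?_⟩
      obtain ⟨c, h1, h2, h3, h4⟩ := AlmostAut.exists_comp_ball (a := (a h).inv) (hB h) (hA h)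
        (hA g') (hB g')
      obtain ⟨τ, hτ⟩ := AlmostAut.exists_ofTreeAut_eq h1 h2 fun v hv => by
        have h5 : (a h).ext v = (a g').ext v :=
          congrArg Subtype.val (congrFun hcode ⟨v, hv⟩)
        rw [h4 v (hnot v hv), ← h5, AlmostAut.ext_inv_ext]
        rw [hA h]
        exact hnot v hv
      refine ⟨τ, ?_⟩
      rw [hτ, h3, ← mk_inv, ha h, ha g']
      exact mul_inv_cancel_left _ _
    · rintro ⟨c, τ, rfl⟩
      exact mul_mem (r c).2 (ofTreeAut_mem_ballSubgroupLevel τ n)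
  rw [hunion]
  exact isCompact_iUnion fun c =>
    (isCompact_range continuous_ofTreeAut).image (continuous_const_mul _)

/-- An open subgroup is closed, so it meets each compact subgroup of the filtration of `O` in a
compact set. -/
theorem isAmenable_of_le_ballSubgroup {H : Subgroup (NeretinGroup d k)}
    (hH : IsOpen (H : Set (NeretinGroup d k))) (hle : H ≤ ballSubgroup d k) : IsAmenable H := by
  refine isAmenable_of_iUnion_compact (K := fun n => (ballSubgroupLevel d k n).subgroupOf H)
    (fun n => ?_) (fun m n hmn => Subgroup.comap_mono (ballSubgroupLevel_mono hmn))
    fun g => exists_mem_ballSubgroupLevel (hle g.2)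
  exact (H.isClosed_of_isOpen hH).isClosedEmbedding_subtypeVal.isCompact_preimage
    (isCompact_ballSubgroupLevel n)

theorem isOpen_ballSubgroup : IsOpen (ballSubgroup d k : Set (NeretinGroup d k)) :=
  isOpen_iff.2 fun _ hg => ⟨0, fun τ _ => mul_mem hg ⟨AlmostAut.ofAut τ, 0, rfl, rfl, rfl⟩⟩

theorem letter_treeAut {τ : treeAut d k} (hτ : ∀ v, v.level ≤ 1 → τ.1 v = v)
    (v : Vertex d k) : (τ.1 v).letter = v.letter := by
  obtain _ | ⟨i, w⟩ := v
  · rw [treeAut_root]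
  · induction w with
    | nil => rw [hτ _ le_rfl]
    | cons j w ih =>
      have h1 : IsParent (node i w : Vertex d k) (node i (j :: w)) := ⟨by simp, rfl⟩
      rw [letter_of_isParent (fun h => by rw [h] at ih; cases ih)
        ((treeAut_isParent τ _ _).2 h1), ih]
      rfl

theorem isOpen_levelOneNormalizer (o : Fin d) :
    IsOpen (levelOneNormalizer d k : Set (NeretinGroup d k)) := by
  -- Automorphisms fixing level one preserve every first letter, so they belong to `O'` with the
  -- identity permutation.
  refine isOpen_iff.2 fun _ hg => ⟨1, fun τ hτ => mul_mem hg ?_⟩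
  refine (mk_mem_levelOneNormalizer_iff o).2 ⟨⟨AlmostAut.ofAut τ, 0, rfl, rfl, rfl⟩, 1,
    Eventually.of_forall fun v => ?_⟩
  rw [AlmostAut.ext_ofAut, letter_treeAut hτ]
  simp

theorem exists_mk_inv {H : Subgroup (NeretinGroup d k)} (x : NeretinGroup d k ⧸ H) :
    ∃ a, x = QuotientGroup.mk (mk a)⁻¹ := by
  obtain ⟨g, rfl⟩ := QuotientGroup.mk_surjective x
  obtain ⟨a, ha⟩ := exists_mk g⁻¹
  exact ⟨a, by rw [← ha, inv_inv]⟩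

end NeretinGroup

end

theorem mainTheorem7 (d k : ℕ) (hd : 2 ≤ d) (hk : 2 ≤ k) :
    (IsOpen (NeretinGroup.ballSubgroup d k : Set (NeretinGroup d k)) ∧
      IsAmenable (NeretinGroup.ballSubgroup d k)) ∧
    (IsOpen (NeretinGroup.levelOneNormalizer d k : Set (NeretinGroup d k)) ∧
      IsAmenable (NeretinGroup.levelOneNormalizer d k)) ∧
    (UnitaryRep.IsStronglyContinuous
        (UnitaryRep.quasiRegular (NeretinGroup.ballSubgroup d k)) ∧
      UnitaryRep.IsIrreducible (UnitaryRep.quasiRegular (NeretinGroup.ballSubgroup d k))) ∧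
    (UnitaryRep.IsStronglyContinuous
        (UnitaryRep.quasiRegular (NeretinGroup.levelOneNormalizer d k)) ∧
      UnitaryRep.IsIrreducible
        (UnitaryRep.quasiRegular (NeretinGroup.levelOneNormalizer d k))) ∧
    ¬ UnitaryRep.AreEquivalent
        (UnitaryRep.quasiRegular (NeretinGroup.ballSubgroup d k))
        (UnitaryRep.quasiRegular (NeretinGroup.levelOneNormalizer d k)) := by
  have hO := NeretinGroup.isOpen_ballSubgroup (d := d) (k := k)
  have hO' := NeretinGroup.isOpen_levelOneNormalizer (k := k) (⟨0, by omega⟩ : Fin d)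
  refine ⟨⟨hO, NeretinGroup.isAmenable_of_le_ballSubgroup hO le_rfl⟩,
    ⟨hO', NeretinGroup.isAmenable_of_le_ballSubgroup hO'
      NeretinGroup.levelOneNormalizer_le_ballSubgroup⟩,
    ⟨UnitaryRep.isStronglyContinuous_quasiRegular _ hO,
      UnitaryRep.isIrreducible_quasiRegular _ fun x hx => ?_⟩,
    ⟨UnitaryRep.isStronglyContinuous_quasiRegular _ hO',
      UnitaryRep.isIrreducible_quasiRegular _ fun x hx => ?_⟩,
    UnitaryRep.not_areEquivalent_quasiRegular _ _ fun x => ?_⟩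
  · obtain ⟨a, rfl⟩ := NeretinGroup.exists_mk_inv x
    exact QuotientGroup.eq.2 (by
      simpa using NeretinGroup.mem_ballSubgroup_of_finite_orbit hd hk hx)
  · obtain ⟨a, rfl⟩ := NeretinGroup.exists_mk_inv x
    exact QuotientGroup.eq.2 (by
      simpa using NeretinGroup.mem_levelOneNormalizer_of_finite_orbit hd hx)
  · obtain ⟨a, rfl⟩ := NeretinGroup.exists_mk_inv x
    exact NeretinGroup.infinite_orbit_levelOneNormalizer hd hk a
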